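/- Let $0<\gamma<2$, $\gamma\neq\frac43$. For $\alpha>0$ put $V(\phi)=\frac1{8\alpha}\bigl(1-e^{-\sqrt{2/3}\,\phi}\bigr)^2$ and $\chi(\phi)=e^{\sqrt{2/3}\,\phi}$ (quadratic gravity $F(R)=R+\alpha R^2$ in the Einstein frame). Consider expanding ($H>0$) flat FRW models with a scalar field $\phi$, matter density $\rho\ge0$ and radiation density $\rho_r\ge0$: $$\dot H=-\tfrac12\bigl(\gamma\rho+\tfrac43\rho_r+\dot\phi^2\bigr),\quad \dot\rho=-3\gamma H\rho-\tfrac12(4-3\gamma)\rho\dot\phi\,\tfrac{d\ln\chi}{d\phi},\quad \dot\rho_r=-4H\rho_r,$$ $$\ddot\phi=-3H\dot\phi-V'(\phi)+\tfrac12(4-3\gamma)\rho\,\tfrac{d\ln\chi}{d\phi},\qquad 3H^2=\tfrac12\dot\phi^2+V(\phi)+\rho+\rho_r .$$ For $\varepsilon>0$ let $\Omega_\varepsilon$ be the set of all $(u,\sigma_2,\sigma_4,\sigma_5)\in\mathbb R^4$ with $\frac1{1-\exp(\sqrt{2/3}/\varepsilon)}\le u\le0$, $\sigma_2^2+\sigma_4^2+\sigma_5^2\le1$,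 $\sigma_4\ge0$, $\sigma_5\ge0$. (i) On time intervals where $\phi\ge 1/\varepsilon$, the variables $$u=\frac1{1-e^{\sqrt{2/3}\,\phi}},\quad \sigma_2=\frac{\dot\phi}{\sqrt6H},\quad \sigma_4=\frac{\sqrt V}{\sqrt3H},\quad \sigma_5=\frac{\sqrt{\rho_r}}{\sqrt3H}$$ lie in $\Omega_\varepsilon$ and satisfy, with $'=d/d\tau$, $d\tau=3H\,dt$, $$\begin{aligned} u'&=\tfrac23u^2\sigma_2-\tfrac23u\sigma_2,\\ \sigma_2'&=\tfrac23u\sigma_4^2+(1-\tfrac\gamma2)\sigma_2^3+\tfrac{3\gamma-4}6\sigma_2^2+\sigma_2\Bigl(-\tfrac\gamma2\sigma_4^2+\tfrac{4-3\gamma}6\sigma_5^2+\tfrac{\gamma-2}2\Bigr)+\tfrac{3\gamma-4}6(\sigma_4^2+\sigma_5^2)+\tfrac{4-3\gamma}6,\\ \sigma_4'&=-\tfrac23u\sigma_2\sigma_4+(1-\tfrac\gamma2)\sigma_2^2\sigma_4-\tfrac\gamma2\sigma_4^3+\sigma_4\Bigl(\tfrac{4-3\gamma}6\sigma_5^2+\tfrac\gamma2\Bigr),\\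 \sigma_5'&=(1-\tfrac\gamma2)\sigma_2^2\sigma_5-\tfrac\gamma2\sigma_4^2\sigma_5+\tfrac{4-3\gamma}6\sigma_5^3+\tfrac{3\gamma-4}6\sigma_5. \end{aligned}\tag{$*$}$$ (ii) The point $q=(0,0,1,0)$ (the de Sitter solution) is an equilibrium of $(*)$. It is unstable (not Lyapunov stable as $\tau\to+\infty$), both for $(*)$ on $\mathbb R^4$ and for the flow of $(*)$ in each phase space $\Omega_\varepsilon$, $\varepsilon>0$. It is a saddle, in $\mathbb R^4$ and in each $\Omega_\varepsilon$: there is a solution other than $q$ that tends to $q$ as $\tau\to+\infty$, and a solution other than $q$ that tends to $q$ as $\tau\to-\infty$. (iii) In the coordinates $u=\frac32x$, $\sigma_2=x+y_1$, $\sigma_4=1+y_2$, $\sigma_5=y_3$ the system $(*)$ takes the form $x'=f(x,\mathbf y)$, $\mathbf y'=B\mathbf y+\mathbf g(x,\mathbf y)$, where $f,\mathbf g$ vanish at $\mathbf 0$ together with their first derivatives and $$B=\begin{pmatrix}-1&\gamma-\frac43&0\\0&-\gamma&0\\0&0&-\frac23\end{pmatrix}$$ has only eigenvalues with negative real part. Call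 a graph $\{\mathbf y=\mathbf h(x),\ |x|<\delta\}$, $\delta>0$, with $\mathbf h(0)=\mathbf 0$, $D\mathbf h(0)=\mathbf 0$, which is locally invariant under the flow, a local center manifold. For every $r\in\mathbb N$ there is a local center manifold with $\mathbf h$ of class $C^r$, and on every local center manifold with $\mathbf h$ of class $C^1$ the flow is $$x'=f(x,\mathbf h(x))=-\tfrac23x^2+O(x^3)\qquad(x\to0).$$ -/

import Mathlib

open Set Filter Topology Asymptotics

noncomputable section

/-! ### Stability notions for an autonomous system `z' = X z` on a phase space `S` -/

/-- Lyapunov stability of `q` for the flow of `z' = X z` in the phase space `S`: solutions in `S`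
that start near `q` stay near `q` for as long as they exist in forward time. -/
def IsLyapunovStableOn {E : Type*} [NormedAddCommGroup E] [NormedSpace ℝ E]
    (X : E → E) (S : Set E) (q : E) : Prop :=
  ∀ ε > 0, ∃ δ > 0, ∀ (T : ℝ) (z : ℝ → E),
    IsIntegralCurveOn z (fun _ => X) (Icc 0 T) → (∀ t ∈ Icc 0 T, z t ∈ S) →
      dist (z 0) q < δ → ∀ t ∈ Icc 0 T, dist (z t) q < ε

/-- `q` is of saddle type for the flow of `z' = X z` in the phase space `S`: it is an equilibrium
which is the limit, as time tends to `+∞`, of a solution in `S` other than the equilibrium itself,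
and also the limit, as time tends to `-∞`, of a solution in `S` other than the equilibrium. -/
def IsSaddleOn {E : Type*} [NormedAddCommGroup E] [NormedSpace ℝ E]
    (X : E → E) (S : Set E) (q : E) : Prop :=
  X q = 0 ∧
  (∃ z : ℝ → E, IsIntegralCurveOn z (fun _ => X) (Ici 0) ∧ (∀ t ∈ Ici (0 : ℝ), z t ∈ S) ∧
    z 0 ≠ q ∧ Tendsto z atTop (𝓝 q)) ∧
  (∃ z : ℝ → E, IsIntegralCurveOn z (fun _ => X) (Iic 0) ∧ (∀ t ∈ Iic (0 : ℝ), z t ∈ S) ∧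
    z 0 ≠ q ∧ Tendsto z atBot (𝓝 q))

/-! ### Center manifolds -/

/-- The vector field `F` on `ℝ × ℝˢ` has the form
`x' = f (x, y)`, `y' = B y + g (x, y)` where `f` and `g` vanish at the origin together with their
first derivatives and all (complex) eigenvalues of `B` have negative real part. -/
def IsCenterForm {s : ℕ} (F : ℝ × (Fin s → ℝ) → ℝ × (Fin s → ℝ))
    (B : Matrix (Fin s) (Fin s) ℝ) : Prop :=
  (∃ (f : ℝ × (Fin s → ℝ) → ℝ) (g : ℝ × (Fin s → ℝ) → (Fin s → ℝ)),
    (∀ p, F p = (f p, B.mulVec p.2 + g p)) ∧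
    f 0 = 0 ∧ g 0 = 0 ∧
    HasFDerivAt f (0 : ℝ × (Fin s → ℝ) →L[ℝ] ℝ) 0 ∧
    HasFDerivAt g (0 : ℝ × (Fin s → ℝ) →L[ℝ] (Fin s → ℝ)) 0) ∧
  ∀ μ ∈ spectrum ℂ (B.map (fun c : ℝ => (c : ℂ))), μ.re < 0

/-- The graph `{(x, h x) : |x| < δ}` is a local center manifold of class `C^r` at the origin for the
system `(x', y') = F (x, y)`: it passes through the origin, is tangent there to `y = 0`, and is
locally invariant (a solution that meets the graph stays on it as long as `|x| < δ`). -/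
structure IsLocalCenterManifold {s : ℕ} (F : ℝ × (Fin s → ℝ) → ℝ × (Fin s → ℝ))
    (r : ℕ) (δ : ℝ) (h : ℝ → (Fin s → ℝ)) : Prop where
  pos : 0 < δ
  contDiffOn : ContDiffOn ℝ r h (Ioo (-δ) δ)
  map_zero : h 0 = 0
  tangent : HasDerivAt h 0 0
  invariant : ∀ (a b : ℝ) (z : ℝ → ℝ × (Fin s → ℝ)), a < 0 → 0 < b →
    IsIntegralCurveOn z (fun _ => F) (Ioo a b) → (z 0).2 = h (z 0).1 →
    (∀ t ∈ Ioo a b, |(z t).1| < δ) → ∀ t ∈ Ioo a b, (z t).2 = h (z t).1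

/-! ### The cosmological model -/

/-- The field equations of an expanding flat FRW model on the time interval `(a, b)`, with a scalar
field `φ` (with `y` its time derivative) of potential `V`, coupled through `χ` to a perfect fluid of
density `ρ` and pressure `(γ - 1) ρ`, and with radiation of density `ρr`; `H` is the Hubble
parameter and `8πG = c = 1`. -/
structure IsFlatFRWSolution (V χ : ℝ → ℝ) (γ a b : ℝ) (H φ y ρ ρr : ℝ → ℝ) : Prop where
  H_pos : ∀ t ∈ Ioo a b, 0 < H t
  rho_nonneg : ∀ t ∈ Ioo a b, 0 ≤ ρ t
  rhor_nonneg : ∀ t ∈ Ioo a b, 0 ≤ ρr t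
  phi_eq : ∀ t ∈ Ioo a b, HasDerivAt φ (y t) t
  y_eq : ∀ t ∈ Ioo a b, HasDerivAt y
    (-3 * H t * y t - deriv V (φ t)
      + 1 / 2 * (4 - 3 * γ) * ρ t * deriv (fun p => Real.log (χ p)) (φ t)) t
  rho_eq : ∀ t ∈ Ioo a b, HasDerivAt ρ
    (-3 * γ * H t * ρ t
      - 1 / 2 * (4 - 3 * γ) * ρ t * y t * deriv (fun p => Real.log (χ p)) (φ t)) t
  rhor_eq : ∀ t ∈ Ioo a b, HasDerivAt ρr (-4 * H t * ρr t) t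
  H_eq : ∀ t ∈ Ioo a b, HasDerivAt H
    (-(1 / 2) * (γ * ρ t + 4 / 3 * ρr t + y t ^ 2)) t
  friedmann : ∀ t ∈ Ioo a b, 3 * H t ^ 2 = 1 / 2 * y t ^ 2 + V (φ t) + ρ t + ρr t

/-- The potential of quadratic gravity `R + α R²`. -/
def quadPotential (α φ : ℝ) : ℝ := 1 / (8 * α) * (1 - Real.exp (-(√(2 / 3) * φ))) ^ 2

/-- The coupling function of quadratic gravity. -/
def quadCoupling (φ : ℝ) : ℝ := Real.exp (√(2 / 3) * φ)

/-- The normalized variables `(u, σ₂, σ₄, σ₅)` of quadratic gravity; `u → 0⁻` as `φ → +∞`. -/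
def quadVars (α H φ y ρr : ℝ) : Fin 4 → ℝ :=
  ![1 / (1 - Real.exp (√(2 / 3) * φ)),
    y / (√6 * H),
    √(quadPotential α φ) / (√3 * H),
    √ρr / (√3 * H)]

/-- The vector field of quadratic gravity in the variables `(u, σ₂, σ₄, σ₅)`. -/
def quadField (γ : ℝ) (z : Fin 4 → ℝ) : Fin 4 → ℝ :=
  let u := z 0
  let σ₂ := z 1
  let σ₄ := z 2
  let σ₅ := z 3
  ![2 / 3 * u ^ 2 * σ₂ - 2 / 3 * u * σ₂,
    2 / 3 * u * σ₄ ^ 2 + (1 - γ / 2) * σ₂ ^ 3 + 1 / 6 * (3 * γ - 4) * σ₂ ^ 2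
      + σ₂ * (-(γ * σ₄ ^ 2 / 2) + 1 / 6 * (4 - 3 * γ) * σ₅ ^ 2 + (γ - 2) / 2)
      + 1 / 6 * (3 * γ - 4) * σ₄ ^ 2 + 1 / 6 * (3 * γ - 4) * σ₅ ^ 2 + 1 / 6 * (4 - 3 * γ),
    -(2 / 3 * u * σ₂ * σ₄) + (1 - γ / 2) * σ₂ ^ 2 * σ₄ - γ * σ₄ ^ 3 / 2
      + σ₄ * (1 / 6 * (4 - 3 * γ) * σ₅ ^ 2 + γ / 2),
    (1 - γ / 2) * σ₂ ^ 2 * σ₅ - 1 / 2 * γ * σ₄ ^ 2 * σ₅ + 1 / 6 * (4 - 3 * γ) * σ₅ ^ 3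
      + 1 / 6 * (3 * γ - 4) * σ₅]

/-- The phase space near `φ = +∞`, the part where `1 / φ ≤ ε`, with `φ = +∞` (`u = 0`) included. -/
def quadPhaseSpace (ε : ℝ) : Set (Fin 4 → ℝ) :=
  {z | 1 / (1 - Real.exp (√(2 / 3) / ε)) ≤ z 0 ∧ z 0 ≤ 0 ∧
    z 1 ^ 2 + z 2 ^ 2 + z 3 ^ 2 ≤ 1 ∧ 0 ≤ z 2 ∧ 0 ≤ z 3}

/-- The de Sitter equilibrium `(u, σ₂, σ₄, σ₅) = (0, 0, 1, 0)`. -/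
def deSitter : Fin 4 → ℝ := ![0, 0, 1, 0]

/-- Affine coordinates `(x, y)` centred at the de Sitter point:
`u = 3 x / 2`, `σ₂ = x + y₀`, `σ₄ = 1 + y₁`, `σ₅ = y₂`. -/
def fromCenterCoords (p : ℝ × (Fin 3 → ℝ)) : Fin 4 → ℝ :=
  ![3 / 2 * p.1, p.1 + p.2 0, 1 + p.2 1, p.2 2]

/-- The inverse coordinate change. -/
def toCenterCoords (z : Fin 4 → ℝ) : ℝ × (Fin 3 → ℝ) :=
  (2 / 3 * z 0, ![z 1 - 2 / 3 * z 0, z 2 - 1, z 3])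

/-- The linear part of `toCenterCoords`, which transforms velocities. -/
def toCenterVel (w : Fin 4 → ℝ) : ℝ × (Fin 3 → ℝ) :=
  (2 / 3 * w 0, ![w 1 - 2 / 3 * w 0, w 2, w 3])

theorem toCenterCoords_fromCenterCoords (p : ℝ × (Fin 3 → ℝ)) :
    toCenterCoords (fromCenterCoords p) = p := by
  obtain ⟨x, y⟩ := p
  refine Prod.ext ?_ (funext fun i => ?_)
  · simp [toCenterCoords, fromCenterCoords]
    ring
  · fin_cases i <;> simp [toCenterCoords, fromCenterCoords] <;> ring

theorem fromCenterCoords_toCenterCoords (z : Fin 4 → ℝ) :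
    fromCenterCoords (toCenterCoords z) = z := by
  funext i
  fin_cases i <;> simp [toCenterCoords, fromCenterCoords] <;> ring

theorem toCenterCoords_sub (z w : Fin 4 → ℝ) :
    toCenterCoords z - toCenterCoords w = toCenterVel (z - w) := by
  refine Prod.ext ?_ (funext fun i => ?_)
  · simp [toCenterCoords, toCenterVel]
    ring
  · fin_cases i <;> simp [toCenterCoords, toCenterVel] <;> ring

/-- The vector field of quadratic gravity in the coordinates `(x, y)`. -/
def centerField (γ : ℝ) (p : ℝ × (Fin 3 → ℝ)) : ℝ × (Fin 3 → ℝ) :=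
  toCenterVel (quadField γ (fromCenterCoords p))

/-- The linear part of the `y`-equation at the de Sitter point. -/
def centerBlock (γ : ℝ) : Matrix (Fin 3) (Fin 3) ℝ :=
  !![-1, γ - 4 / 3, 0; 0, -γ, 0; 0, 0, -(2 / 3)]

end

/-! At the de Sitter point the linearization has eigenvalues 0, -1, -γ, -2/3, so the type of the
point is decided along the center direction. There the flow is `x' = -(2/3) x² + ...`: the side `x >
0` is attracted and the side `x < 0`, which is the physical side `u < 0`, is repelled. A solution on
the repelled side, followed backwards, emanates from the point. A solution tending to the point is
explicit: radiation with a cosmological constant, on `u = σ₂ = 0`.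

A center manifold is constructed by hand inside the invariant surface `σ₅ = 0`, `σ₂² + σ₄² = 1` (no
matter, no radiation), where only one scalar equation remains. With `σ₂ = x k(x)` it becomes a
singular equation `x² k' A(x, k) = B(x, k)` with polynomial `A`, `B` and `B(0, k) = k - 1`. The time
`t = -1/x` turns such an equation into a small perturbation of `y' = l y`, `l > 0`, and a
contraction on functions vanishing at infinity yields a solution continuous at `x = 0`
(`IsSingularEquation.exists_continuous_solution`). Substituting `v = c + u w` reproduces an equation
of the same kind (`IsSingularEquation.exists_blowUp`), and doing this twice gains one derivative,
hence every class `C^r`. The resulting graph is tangent to the field, so `eq_graph_of_tangent` makes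
it invariant.

On an arbitrary `C¹` center manifold, invariance gives `B h = f h' - g`. The right side is `O(x²)`,
so `h = O(x²)` in the components that matter, and the reduced flow follows.

Instability needs no separate argument: a solution that emanates from the point contradicts Lyapunov
stability. -/

/-! ### Singular scalar equations with polynomial coefficients and their blow-up. -/

/-- Polynomial functions of two real variables. -/
inductive IsPolyFun : (ℝ × ℝ → ℝ) → Prop
  | const (c : ℝ) : IsPolyFun fun _ => c
  | fst : IsPolyFun fun p => p.1
  | snd : IsPolyFun fun p => p.2
  | add {P Q : ℝ × ℝ → ℝ} : IsPolyFun P → IsPolyFun Q → IsPolyFun fun p => P p + Q p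
  | mul {P Q : ℝ × ℝ → ℝ} : IsPolyFun P → IsPolyFun Q → IsPolyFun fun p => P p * Q p

namespace IsPolyFun

theorem sub {P Q : ℝ × ℝ → ℝ} (hP : IsPolyFun P) (hQ : IsPolyFun Q) :
    IsPolyFun fun p => P p - Q p := by
  simpa [sub_eq_add_neg] using hP.add ((const (-1)).mul hQ)

theorem contDiff {P : ℝ × ℝ → ℝ} (hP : IsPolyFun P) {n : WithTop ℕ∞} : ContDiff ℝ n P := by
  induction hP with
  | const c => exact contDiff_const
  | fst => exact contDiff_fst
  | snd => exact contDiff_snd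
  | add _ _ h₁ h₂ => exact h₁.add h₂
  | mul _ _ h₁ h₂ => exact h₁.mul h₂

theorem comp {P Q R : ℝ × ℝ → ℝ} (hP : IsPolyFun P) (hQ : IsPolyFun Q) (hR : IsPolyFun R) :
    IsPolyFun fun p => P (Q p, R p) := by
  induction hP with
  | const c => exact const c
  | fst => exact hQ
  | snd => exact hR
  | add _ _ h₁ h₂ => exact h₁.add h₂
  | mul _ _ h₁ h₂ => exact h₁.mul h₂

/-- The difference `P (u, c + u w) - P (0, c)` vanishes at `u = 0`, hence is divisible by `u` with
polynomial quotient. Induction on the construction of `P` avoids any Taylor remainder and keeps the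
blown-up coefficients polynomial. -/
theorem exists_blowUp {P : ℝ × ℝ → ℝ} (hP : IsPolyFun P) (c : ℝ) :
    ∃ Q, IsPolyFun Q ∧ ∀ u w, P (u, c + u * w) = P (0, c) + u * Q (u, w) := by
  induction hP with
  | const a => exact ⟨_, const 0, by simp⟩
  | fst => exact ⟨_, const 1, by simp⟩
  | snd => exact ⟨_, snd, by simp⟩
  | @add P₁ P₂ _ _ h₁ h₂ =>
    obtain ⟨Q₁, hQ₁, e₁⟩ := h₁
    obtain ⟨Q₂, hQ₂, e₂⟩ := h₂
    refine ⟨_, hQ₁.add hQ₂, fun u w => ?_⟩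
    simp only [e₁, e₂]
    ring
  | @mul P₁ P₂ _ _ h₁ h₂ =>
    obtain ⟨Q₁, hQ₁, e₁⟩ := h₁
    obtain ⟨Q₂, hQ₂, e₂⟩ := h₂
    refine ⟨_, (((const (P₁ (0, c))).mul hQ₂).add ((const (P₂ (0, c))).mul hQ₁)).add
      ((fst.mul hQ₁).mul hQ₂), fun u w => ?_⟩
    simp only [e₁, e₂]
    ring

end IsPolyFun

/-- The data of a singular scalar equation `u² v' A(u, v) = B(u, v)` with polynomial coefficients
whose reduced equation `B(0, v) = 0` has the repelling simple root `c`. -/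
structure IsSingularEquation (A B : ℝ × ℝ → ℝ) (c : ℝ) : Prop where
  left : IsPolyFun A
  right : IsPolyFun B
  pos : 0 < A (0, c)
  root : B (0, c) = 0
  slope : ∃ l > 0, HasDerivAt (fun v => B (0, v)) l c

/-- Substituting `v = c + u w` yields a singular equation of the same kind for `w`. -/
theorem IsSingularEquation.exists_blowUp {A B : ℝ × ℝ → ℝ} {c : ℝ}
    (h : IsSingularEquation A B c) :
    ∃ (A' B' : ℝ × ℝ → ℝ) (c' : ℝ), IsSingularEquation A' B' c' ∧
      (∀ u w, A (u, c + u * w) = A' (u, w)) ∧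
      ∀ u w, B (u, c + u * w) = u * (B' (u, w) + u * w * A' (u, w)) := by
  obtain ⟨l, hl, hB⟩ := h.slope
  obtain ⟨Q, hQ, e⟩ := h.right.exists_blowUp c
  -- Since `B (u, c + u w) = u Q (u, w)`, the value `Q (0, w)` is the derivative of `B` at `(0, c)`
  -- in the direction `(1, w)`. It is therefore affine in `w` with slope `∂B/∂v = l`, so the new
  -- root is again simple and repelling, with the same slope.
  have hQ0 : ∀ w, Q (0, w) = Q (0, 0) + w * l := by
    have hL : HasFDerivAt B (fderiv ℝ B (0, c)) (0, c) :=
      (h.right.contDiff.differentiable one_ne_zero).differentiableAt.hasFDerivAt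
    set L := fderiv ℝ B (0, c)
    have hL1 : ∀ w, Q (0, w) = L (1, w) := by
      intro w
      have hc : HasDerivAt (fun u : ℝ => (u, c + u * w)) ((1 : ℝ), w) 0 := by
        have := (hasDerivAt_id (0 : ℝ)).prodMk (((hasDerivAt_id (0 : ℝ)).mul_const w).const_add c)
        simpa using this
      have h1 : HasDerivAt (fun u : ℝ => B (u, c + u * w)) (L (1, w)) 0 := by
        refine HasFDerivAt.comp_hasDerivAt (0 : ℝ) (f := fun u : ℝ => (u, c + u * w)) ?_ hc
        simpa using hL
      have hd : DifferentiableAt ℝ (fun u : ℝ => Q (u, w)) 0 :=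
        ((hQ.contDiff (n := 1)).comp (contDiff_id.prodMk contDiff_const)).differentiable
          one_ne_zero |>.differentiableAt
      have h2 := (hasDerivAt_id (0 : ℝ)).mul hd.hasDerivAt
      have h3 : (fun u : ℝ => B (u, c + u * w)) = (fun u => id u * Q (u, w)) := by
        funext u
        rw [e, h.root, zero_add, id]
      rw [h3] at h1
      simpa using h2.unique h1
    have hL2 : L (0, 1) = l := by
      have hc : HasDerivAt (fun v : ℝ => ((0 : ℝ), v)) ((0 : ℝ), (1 : ℝ)) c :=
        (hasDerivAt_const c (0 : ℝ)).prodMk (hasDerivAt_id c)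
      exact (HasFDerivAt.comp_hasDerivAt c (f := fun v : ℝ => ((0 : ℝ), v)) hL hc).unique hB
    intro w
    rw [hL1, hL1, ← hL2, ← smul_eq_mul, ← map_smul, ← map_add]
    simp
  refine ⟨fun p => A (p.1, c + p.1 * p.2),
    fun p => Q p - p.1 * p.2 * A (p.1, c + p.1 * p.2), -Q (0, 0) / l, ?_, fun _ _ => rfl, ?_⟩
  · have hA : IsPolyFun fun p : ℝ × ℝ => A (p.1, c + p.1 * p.2) :=
      h.left.comp .fst ((IsPolyFun.const c).add (.mul .fst .snd))
    refine ⟨hA, hQ.sub ((IsPolyFun.mul .fst .snd).mul hA), by simpa using h.pos, ?_, l, hl, ?_⟩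
    · rw [hQ0]
      field_simp
      ring
    · have hQ' : (fun w => Q (0, w) - 0 * w * A (0, c + 0 * w)) = fun w => Q (0, 0) + w * l := by
        funext w
        rw [hQ0]
        ring
      rw [hQ']
      simpa using (((hasDerivAt_id (-Q (0, 0) / l)).mul_const l).const_add (Q (0, 0)))
  · intro u w
    rw [e, h.root]
    ring

/-! ### Solutions of perturbed repelling linear equations that vanish at infinity. -/

open MeasureTheory in
theorem integrableOn_exp_neg_mul_mul {l M : ℝ} (hl : 0 < l) {g : ℝ → ℝ} (hg : Continuous g)
    (hM : ∀ t, |g t| ≤ M) (a : ℝ) : IntegrableOn (fun s => Real.exp (-l * s) * g s) (Ioi a) := by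
  refine Integrable.mono' ((integrableOn_exp_mul_Ioi (neg_lt_zero.2 hl) a).mul_const M)
    (by fun_prop) (Eventually.of_forall fun s => ?_)
  rw [Real.norm_eq_abs, abs_mul, Real.abs_exp]
  exact mul_le_mul_of_nonneg_left (hM s) (Real.exp_pos _).le

/-- The bounded solution of `y' = l y + g` for bounded `g` and `l > 0`. -/
noncomputable def boundedSolution (l : ℝ) (g : ℝ → ℝ) (t : ℝ) : ℝ :=
  -∫ s in Ioi (0 : ℝ), Real.exp (-l * s) * g (t + s)

open MeasureTheory in
theorem hasDerivAt_boundedSolution {l M : ℝ} (hl : 0 < l) {g : ℝ → ℝ} (hg : Continuous g)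
    (hM : ∀ t, |g t| ≤ M) (t : ℝ) :
    HasDerivAt (boundedSolution l g) (l * boundedSolution l g t + g t) t := by
  -- In this form `t` enters only through the exponential and a limit of integration, so
  -- differentiation requires only continuity of `g`.
  have key : ∀ t, boundedSolution l g t = Real.exp (l * t) *
      ((∫ s in (0 : ℝ)..t, Real.exp (-l * s) * g s)
        - ∫ s in Ioi (0 : ℝ), Real.exp (-l * s) * g s) := by
    intro t
    have h1 := intervalIntegral.integral_Ioi_sub_Ioi'
      (integrableOn_exp_neg_mul_mul hl hg hM 0) (integrableOn_exp_neg_mul_mul hl hg hM t)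
    have h2 : ∫ s in Ioi t, Real.exp (-l * s) * g s
        = ∫ s in Ioi (0 : ℝ), Real.exp (-l * (t + s)) * g (t + s) := by
      have hmp : MeasurePreserving (fun s : ℝ => t + s) volume volume :=
        measurePreserving_add_left volume t
      have := hmp.setIntegral_preimage_emb (measurableEmbedding_addLeft t)
        (fun s => Real.exp (-l * s) * g s) (Ioi t)
      rw [← this]
      simp
    have h3 : ∀ s, Real.exp (-l * (t + s)) * g (t + s)
        = Real.exp (-(l * t)) * (Real.exp (-l * s) * g (t + s)) := by
      intro s
      rw [← mul_assoc, ← Real.exp_add]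
      ring_nf
    simp only [h3, integral_const_mul] at h2
    rw [← h1, sub_sub_cancel_left, h2, boundedSolution, mul_neg, ← mul_assoc, ← Real.exp_add]
    simp
  have hc : Continuous fun s => Real.exp (-l * s) * g s := by fun_prop
  have hI : HasDerivAt (fun t => ∫ s in (0 : ℝ)..t, Real.exp (-l * s) * g s)
      (Real.exp (-l * t) * g t) t :=
    intervalIntegral.integral_hasDerivAt_right (hc.intervalIntegrable _ _)
      hc.stronglyMeasurable.stronglyMeasurableAtFilter hc.continuousAt
  have hE : HasDerivAt (fun t => Real.exp (l * t)) (Real.exp (l * t) * l) t := by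
    simpa using ((hasDerivAt_id t).const_mul l).exp
  have hD := hE.mul (hI.sub_const (∫ s in Ioi (0 : ℝ), Real.exp (-l * s) * g s))
  rw [funext key]
  refine hD.congr_deriv ?_
  have : Real.exp (l * t) * (Real.exp (-l * t) * g t) = g t := by
    rw [← mul_assoc, ← Real.exp_add]
    simp
  rw [this]
  ring

open MeasureTheory in
theorem abs_boundedSolution_sub_le {l M N C : ℝ} (hl : 0 < l) {g₁ g₂ : ℝ → ℝ}
    (h₁ : Continuous g₁) (h₂ : Continuous g₂) (hM : ∀ t, |g₁ t| ≤ M) (hN : ∀ t, |g₂ t| ≤ N)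
    (hC : ∀ t, |g₁ t - g₂ t| ≤ C) (t : ℝ) :
    |boundedSolution l g₁ t - boundedSolution l g₂ t| ≤ C / l := by
  have i₁ := integrableOn_exp_neg_mul_mul hl (h₁.comp (continuous_const_add t))
    (fun s => hM (t + s)) 0
  have i₂ := integrableOn_exp_neg_mul_mul hl (h₂.comp (continuous_const_add t))
    (fun s => hN (t + s)) 0
  have e : boundedSolution l g₁ t - boundedSolution l g₂ t
      = -∫ s in Ioi (0 : ℝ), Real.exp (-l * s) * (g₁ (t + s) - g₂ (t + s)) := by
    have := integral_sub i₁ i₂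
    simp only [Function.comp_apply, ← mul_sub] at this
    rw [this, boundedSolution, boundedSolution]
    ring
  have hb : ∫ s in Ioi (0 : ℝ), Real.exp (-l * s) * C = C / l := by
    rw [integral_mul_const, integral_exp_mul_Ioi (neg_lt_zero.2 hl)]
    simp
    field_simp
  rw [e, abs_neg, ← hb]
  rw [← Real.norm_eq_abs]
  refine norm_integral_le_of_norm_le
    ((integrableOn_exp_mul_Ioi (neg_lt_zero.2 hl) 0).mul_const C)
    (Eventually.of_forall fun s => ?_)
  rw [Real.norm_eq_abs, abs_mul, Real.abs_exp]
  exact mul_le_mul_of_nonneg_left (hC _) (Real.exp_pos _).le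

-- Dominated convergence: for fixed `s` the integrand tends to zero as `t → ±∞`, under the bound `M
-- e^{-l s}`.
open MeasureTheory in
theorem tendsto_boundedSolution {l M : ℝ} (hl : 0 < l) {g : ℝ → ℝ} (hg : Continuous g)
    (hM : ∀ t, |g t| ≤ M) (h0 : Tendsto g (cocompact ℝ) (𝓝 0)) :
    Tendsto (boundedSolution l g) (cocompact ℝ) (𝓝 0) := by
  have : (cocompact ℝ).IsCountablyGenerated := by
    rw [cocompact_eq_atBot_atTop]
    infer_instance
  have h := tendsto_integral_filter_of_dominated_convergence (μ := volume.restrict (Ioi (0 : ℝ)))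
    (l := cocompact ℝ) (F := fun t s => Real.exp (-l * s) * g (t + s)) (f := fun _ => 0)
    (fun s => Real.exp (-l * s) * M)
    (Eventually.of_forall fun t => (by fun_prop))
    (Eventually.of_forall fun t => Eventually.of_forall fun s => by
      rw [Real.norm_eq_abs, abs_mul, Real.abs_exp]
      exact mul_le_mul_of_nonneg_left (hM _) (Real.exp_pos _).le)
    ((integrableOn_exp_mul_Ioi (neg_lt_zero.2 hl) 0).mul_const M)
    (Eventually.of_forall fun s => by
      have hs : Tendsto (fun t : ℝ => t + s) (cocompact ℝ) (cocompact ℝ) :=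
        (Homeomorph.addRight s).isClosedEmbedding.tendsto_cocompact
      simpa using (h0.comp hs).const_mul (Real.exp (-l * s)))
  rw [integral_zero] at h
  have h' := h.neg
  rwa [neg_zero] at h'

open ZeroAtInfty in
/-- A small Lipschitz perturbation of `y' = l y`, `l > 0`, that vanishes at infinity has a solution
that vanishes at infinity. -/
theorem exists_solution_tendsto_zero {l k : ℝ} (hk : k < l) (hk0 : 0 ≤ k)
    {R : ℝ → ℝ → ℝ} (hR : Continuous (Function.uncurry R))
    (hlip : ∀ t y z, |R t y - R t z| ≤ k * |y - z|)
    (h0 : Tendsto (fun t => R t 0) (cocompact ℝ) (𝓝 0)) :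
    ∃ y : ℝ → ℝ, Tendsto y (cocompact ℝ) (𝓝 0) ∧ ∀ t, HasDerivAt y (l * y t + R t (y t)) t := by
  have hl : 0 < l := hk0.trans_lt hk
  have hgc : ∀ y : C₀(ℝ, ℝ), Continuous fun t => R t (y t) := fun y =>
    hR.comp (continuous_id.prodMk y.continuous)
  have hg0 : ∀ y : C₀(ℝ, ℝ), Tendsto (fun t => R t (y t)) (cocompact ℝ) (𝓝 0) := by
    intro y
    have hy : Tendsto (fun t => k * |y t|) (cocompact ℝ) (𝓝 0) := by
      simpa using (y.zero_at_infty'.abs).const_mul k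
    have h1 : Tendsto (fun t => R t (y t) - R t 0) (cocompact ℝ) (𝓝 0) :=
      squeeze_zero_norm (fun t => by simpa using hlip t (y t) 0) hy
    simpa using h1.add h0
  let G : C₀(ℝ, ℝ) → C₀(ℝ, ℝ) := fun y => ⟨⟨fun t => R t (y t), hgc y⟩, hg0 y⟩
  have hGb : ∀ y t, |R t (y t)| ≤ ‖(G y).toBCF‖ := fun y t => (G y).toBCF.norm_coe_le_norm t
  let T : C₀(ℝ, ℝ) → C₀(ℝ, ℝ) := fun y =>
    ⟨⟨boundedSolution l fun t => R t (y t), continuous_iff_continuousAt.2 fun t =>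
      (hasDerivAt_boundedSolution hl (hgc y) (hGb y) t).continuousAt⟩,
      tendsto_boundedSolution hl (hgc y) (hGb y) (hg0 y)⟩
  -- The Lipschitz constant `k` of the perturbation is divided by `l`, the total mass of `e^{-l s}`
  -- on the half-line being `1 / l`.
  have hT : ContractingWith (k / l).toNNReal T := by
    refine ⟨by simpa using (div_lt_one hl).2 hk,
      LipschitzWith.of_dist_le_mul fun y z => ?_⟩
    rw [← ZeroAtInftyContinuousMap.dist_toBCF_eq_dist, BoundedContinuousFunction.dist_le
      (by positivity)]
    intro t
    have := abs_boundedSolution_sub_le hl (hgc y) (hgc z) (hGb y) (hGb z)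
      (C := k * dist y z) (fun t => (hlip t _ _).trans ?_) t
    · refine this.trans_eq ?_
      rw [Real.coe_toNNReal _ (by positivity)]
      ring
    · refine mul_le_mul_of_nonneg_left ?_ hk0
      rw [← ZeroAtInftyContinuousMap.dist_toBCF_eq_dist]
      exact BoundedContinuousFunction.dist_coe_le_dist (f := y.toBCF) (g := z.toBCF) t
  let y := ContractingWith.fixedPoint T hT
  have hy : T y = y := hT.fixedPoint_isFixedPt
  have hyt : ∀ t, boundedSolution l (fun t => R t (y t)) t = y t := fun t => by
    conv_rhs => rw [← hy]
    rfl
  refine ⟨y, y.zero_at_infty', fun t => ?_⟩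
  have := hasDerivAt_boundedSolution hl (hgc y) (hGb y) t
  rwa [hyt, funext hyt] at this

/-! ### Continuous, then `C^r`, solutions of singular equations. -/

/-- Because `B (0, c) = 0`, the quotient `B / A` has `v`-derivative `l = m / A (0, c)` at `(0, c)`.
After removal of `l y` the `y`-derivative vanishes there, and strict differentiability makes the
Lipschitz constant in `y` arbitrarily small nearby; `l / 2` suffices for the contraction. -/
theorem IsSingularEquation.exists_box {A B : ℝ × ℝ → ℝ} {c : ℝ} (h : IsSingularEquation A B c) :
    ∃ l > 0, ∃ r > 0, (∀ u y, |u| ≤ r → |y| ≤ r → 0 < A (u, c + y)) ∧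
      ∀ u y z, |u| ≤ r → |y| ≤ r → |z| ≤ r →
        |(B (u, c + y) / A (u, c + y) - l * y) - (B (u, c + z) / A (u, c + z) - l * z)|
          ≤ l / 2 * |y - z| := by
  obtain ⟨m, hm, hB⟩ := h.slope
  set l := m / A (0, c) with hl
  have hl0 : 0 < l := div_pos hm h.pos
  let R : ℝ × ℝ → ℝ := fun p => B (p.1, c + p.2) / A (p.1, c + p.2) - l * p.2
  have hshift : ContDiff ℝ 1 fun p : ℝ × ℝ => (p.1, c + p.2) := by fun_prop
  have hA := (h.left.contDiff (n := 1)).comp hshift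
  have hBc := (h.right.contDiff (n := 1)).comp hshift
  have hA0 : 0 < (A ∘ fun p : ℝ × ℝ => (p.1, c + p.2)) (0, 0) := by simpa using h.pos
  have hR : ContDiffAt ℝ 1 R (0, 0) :=
    (hBc.contDiffAt.div hA.contDiffAt hA0.ne').sub (by fun_prop)
  have hS : HasStrictFDerivAt R (fderiv ℝ R (0, 0)) (0, 0) :=
    hR.hasStrictFDerivAt one_ne_zero
  set L := fderiv ℝ R (0, 0)
  have hL : L (0, 1) = 0 := by
    have hc : HasDerivAt (fun v : ℝ => ((0 : ℝ), v)) ((0 : ℝ), (1 : ℝ)) 0 :=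
      (hasDerivAt_const 0 (0 : ℝ)).prodMk (hasDerivAt_id 0)
    have h1 := HasFDerivAt.comp_hasDerivAt (0 : ℝ) (f := fun v : ℝ => ((0 : ℝ), v))
      hS.hasFDerivAt hc
    have hs : HasDerivAt (fun y : ℝ => c + y) 1 0 := (hasDerivAt_id 0).const_add c
    have hA1 : DifferentiableAt ℝ (fun v => A (0, v)) c :=
      ((h.left.contDiff (n := 1)).comp (contDiff_const.prodMk contDiff_id)).differentiable
        one_ne_zero |>.differentiableAt
    have h2 : HasDerivAt (fun v => B (0, v) / A (0, v)) l c := by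
      refine (hB.div hA1.hasDerivAt h.pos.ne').congr_deriv ?_
      rw [h.root, hl]
      have := h.pos.ne'
      field_simp
      ring
    have h3 : HasDerivAt (fun y : ℝ => B (0, c + y) / A (0, c + y)) (l * 1) 0 := by
      refine HasDerivAt.comp (0 : ℝ) (h₂ := fun v => B (0, v) / A (0, v)) ?_ hs
      simpa using h2
    have h4 := h3.sub ((hasDerivAt_id (0 : ℝ)).const_mul l)
    rw [sub_self] at h4
    exact h1.unique h4
  have e1 := hS.isLittleO.def (half_pos hl0)
  have e2 : ∀ᶠ p in 𝓝 ((0 : ℝ), (0 : ℝ)), 0 < (A ∘ fun p : ℝ × ℝ => (p.1, c + p.2)) p :=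
    hA.continuous.continuousAt.eventually (lt_mem_nhds hA0)
  obtain ⟨r₁, hr₁, H₁⟩ := Metric.eventually_nhds_iff.1 e1
  obtain ⟨r₂, hr₂, H₂⟩ := Metric.eventually_nhds_iff.1 e2
  have hr : 0 < min r₁ r₂ / 2 := by positivity
  refine ⟨l, hl0, min r₁ r₂ / 2, hr, fun u y hu hy => ?_, fun u y z hu hy hz => ?_⟩
  · refine H₂ (y := (u, y)) ?_
    have : min r₁ r₂ / 2 < r₂ := by linarith [min_le_right r₁ r₂]
    simp only [Prod.dist_eq, Real.dist_eq, sub_zero]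
    exact max_lt (hu.trans_lt this) (hy.trans_lt this)
  · have h1 : min r₁ r₂ / 2 < r₁ := by linarith [min_le_left r₁ r₂]
    have := H₁ (y := ((u, y), (u, z))) (by
      simp only [Prod.dist_eq, Real.dist_eq, sub_zero]
      exact max_lt (max_lt (hu.trans_lt h1) (hy.trans_lt h1))
        (max_lt (hu.trans_lt h1) (hz.trans_lt h1)))
    have e : ((u, y) : ℝ × ℝ) - (u, z) = (y - z) • ((0 : ℝ), (1 : ℝ)) := by simp
    simp only [e, map_smul, hL, smul_zero, sub_zero, norm_smul] at this
    simpa [R] using this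

theorem abs_clamp_le {r : ℝ} (hr : 0 ≤ r) (y : ℝ) : |max (-r) (min r y)| ≤ r :=
  abs_le.2 ⟨le_max_left _ _, max_le (by linarith) (min_le_left _ _)⟩

theorem abs_clamp_sub_le (r y z : ℝ) :
    |max (-r) (min r y) - max (-r) (min r z)| ≤ |y - z| := by
  refine (abs_max_sub_max_le_max _ _ _ _).trans ?_
  refine max_le (by simp) ((abs_min_sub_min_le_max _ _ _ _).trans ?_)
  simp

/-- With `t = -1/u` one has `u² d/du = d/dt`, so `v = c + y` solves `y' = B / A`, a perturbation of
`y' = l y`. The two sides of `u = 0` are the two ends `t → ±∞`, so a solution vanishing at both ends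
extends continuously by `c`. -/
theorem IsSingularEquation.exists_continuous_solution {A B : ℝ × ℝ → ℝ} {c : ℝ}
    (h : IsSingularEquation A B c) :
    ∃ δ > 0, ∃ v : ℝ → ℝ, v 0 = c ∧ ContinuousOn v (Ioo (-δ) δ) ∧
      (∀ u ∈ Ioo (-δ) δ, 0 < A (u, v u)) ∧
      ∀ u ∈ Ioo (-δ) δ, u ≠ 0 → HasDerivAt v (B (u, v u) / (A (u, v u) * u ^ 2)) u := by
  obtain ⟨l, hl, r, hr, hA, hlip⟩ := h.exists_box
  -- This is `-1/t` for `|t| ≥ 1 / r`, continued through `t = 0` so that it is continuous and `|U| ≤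
  -- r` everywhere.
  let U : ℝ → ℝ := fun t => -t / max (t ^ 2) ((1 / r) ^ 2)
  have hmax : ∀ t : ℝ, 0 < max (t ^ 2) ((1 / r) ^ 2) := fun t =>
    lt_max_of_lt_right (by positivity)
  have hUc : Continuous U := by
    refine continuous_neg.div (by fun_prop) fun t => (hmax t).ne'
  have hUr : ∀ t, |U t| ≤ r := by
    intro t
    rw [abs_div, abs_neg, abs_of_pos (hmax t), div_le_iff₀ (hmax t)]
    rcases le_total (|t|) (1 / r) with ht | ht
    · refine (ht.trans_eq ?_).trans (mul_le_mul_of_nonneg_left (le_max_right _ _) hr.le)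
      field_simp
    · refine le_trans ?_ (mul_le_mul_of_nonneg_left (le_max_left _ _) hr.le)
      rw [← sq_abs]
      rw [div_le_iff₀ hr] at ht
      nlinarith [abs_nonneg t]
  have hU : ∀ u, u ≠ 0 → |u| ≤ r → U (-u⁻¹) = u := by
    intro u hu hur
    have : max ((-u⁻¹) ^ 2) ((1 / r) ^ 2) = (u⁻¹) ^ 2 := by
      rw [neg_sq, max_eq_left]
      rw [one_div, ← sq_abs u⁻¹, abs_inv]
      gcongr
    simp only [U, this]
    field_simp
  have hU0 : Tendsto U (cocompact ℝ) (𝓝 0) := by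
    refine squeeze_zero_norm' (a := fun t => |t⁻¹|) ?_ ?_
    · filter_upwards with t
      rw [Real.norm_eq_abs, abs_div, abs_neg, abs_of_pos (hmax t), div_le_iff₀ (hmax t)]
      refine le_trans ?_ (mul_le_mul_of_nonneg_left (le_max_left _ _) (abs_nonneg _))
      rcases eq_or_ne t 0 with rfl | ht
      · simp
      · rw [← sq_abs, abs_inv, sq, inv_mul_cancel_left₀ (abs_ne_zero.2 ht)]
    · simpa using (tendsto_inv₀_cobounded (α := ℝ)).abs
  -- Clamping `y` to `[-r, r]` makes the local Lipschitz bound global; the clamp is inactive near `u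
  -- = 0`, where `y (-1/u)` is small.
  let R : ℝ → ℝ → ℝ := fun t y =>
    B (U t, c + max (-r) (min r y)) / A (U t, c + max (-r) (min r y)) - l * max (-r) (min r y)
  have hRc : Continuous (Function.uncurry R) := by
    have hc : Continuous fun p : ℝ × ℝ => (U p.1, c + max (-r) (min r p.2)) := by fun_prop
    exact ((h.right.contDiff (n := 0)).continuous.comp hc).div
      ((h.left.contDiff (n := 0)).continuous.comp hc)
      (fun p => (hA _ _ (hUr _) (abs_clamp_le hr.le _)).ne') |>.sub (by fun_prop)
  have hRl : ∀ t y z, |R t y - R t z| ≤ l / 2 * |y - z| := fun t y z =>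
    (hlip _ _ _ (hUr t) (abs_clamp_le hr.le y) (abs_clamp_le hr.le z)).trans
      (mul_le_mul_of_nonneg_left (abs_clamp_sub_le r y z) (by positivity))
  have hR0 : Tendsto (fun t => R t 0) (cocompact ℝ) (𝓝 0) := by
    have e : (fun t => R t 0) = (fun u => B (u, c) / A (u, c)) ∘ U := by
      funext t
      simp [R, hr.le]
    have hc : ContinuousAt (fun u => B (u, c) / A (u, c)) 0 :=
      ((h.right.contDiff (n := 0)).continuous.comp
        (continuous_id.prodMk continuous_const)).continuousAt.div
      ((h.left.contDiff (n := 0)).continuous.comp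
        (continuous_id.prodMk continuous_const)).continuousAt h.pos.ne'
    rw [e]
    have := hc.tendsto
    rw [h.root, zero_div] at this
    exact this.comp hU0
  obtain ⟨y, hy0, hy⟩ := exists_solution_tendsto_zero (half_lt_self hl) (half_pos hl).le hRc hRl hR0
  have hlim : Tendsto (fun u : ℝ => y (-u⁻¹)) (𝓝[≠] 0) (𝓝 0) := by
    refine hy0.comp ?_
    rw [← Metric.cobounded_eq_cocompact]
    exact tendsto_neg_cobounded.comp tendsto_inv₀_nhdsNE_zero
  obtain ⟨s, hs, H⟩ := Metric.eventually_nhds_iff.1 (eventually_nhdsWithin_iff.1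
    (hlim.eventually (Metric.ball_mem_nhds 0 hr)))
  have H' : ∀ u ∈ Ioo (-min s r) (min s r), u ≠ 0 → |u| ≤ r ∧ |y (-u⁻¹)| ≤ r := by
    intro u hu hu0
    have hu' := abs_lt.2 hu
    refine ⟨(hu'.trans_le (min_le_right _ _)).le, ?_⟩
    have := H (y := u) (by simpa using hu'.trans_le (min_le_left _ _)) hu0
    rw [dist_zero_right] at this
    exact this.le
  let v : ℝ → ℝ := fun u => if u = 0 then c else c + y (-u⁻¹)
  have hv0 : v 0 = c := if_pos rfl
  have hv : ∀ u, u ≠ 0 → v u = c + y (-u⁻¹) := fun u hu => if_neg hu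
  have hd : ∀ u ∈ Ioo (-min s r) (min s r), u ≠ 0 →
      HasDerivAt v (B (u, v u) / (A (u, v u) * u ^ 2)) u := by
    intro u hu hu0
    obtain ⟨h1, h2⟩ := H' u hu hu0
    have h3 : HasDerivAt (fun u => c + y (-u⁻¹))
        ((l * y (-u⁻¹) + R (-u⁻¹) (y (-u⁻¹))) * -(-(u ^ 2)⁻¹)) u :=
      ((hy (-u⁻¹)).comp u (hasDerivAt_inv hu0).neg).const_add c
    have h4 : v =ᶠ[𝓝 u] fun u => c + y (-u⁻¹) := by
      filter_upwards [isOpen_ne.mem_nhds hu0] with w hw using hv w hw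
    refine (h3.congr_of_eventuallyEq h4).congr_deriv ?_
    have h5 : max (-r) (min r (y (-u⁻¹))) = y (-u⁻¹) := by
      rw [min_eq_right (abs_le.1 h2).2, max_eq_right (abs_le.1 h2).1]
    simp only [R, hU u hu0 h1, h5, hv u hu0]
    field_simp
    ring
  refine ⟨min s r, by positivity, v, hv0, fun u hu => ?_, fun u hu => ?_, hd⟩
  · refine ContinuousAt.continuousWithinAt ?_
    rcases eq_or_ne u 0 with rfl | hu0
    · rw [continuousAt_iff_punctured_nhds, hv0]
      have : Tendsto (fun u : ℝ => c + y (-u⁻¹)) (𝓝[≠] 0) (𝓝 c) := by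
        simpa using hlim.const_add c
      refine this.congr' ?_
      filter_upwards [self_mem_nhdsWithin] with w hw using (hv w hw).symm
    · exact (hd u hu hu0).continuousAt
  · rcases eq_or_ne u 0 with rfl | hu0
    · rw [hv0]
      exact h.pos
    · rw [hv u hu0]
      exact hA _ _ (H' u hu hu0).1 (H' u hu hu0).2

/-- A singular equation has, near the origin, a solution of class `C^r`. -/
theorem IsSingularEquation.exists_contDiffOn_solution (r : ℕ) :
    ∀ {A B : ℝ × ℝ → ℝ} {c : ℝ}, IsSingularEquation A B c →
    ∃ δ > 0, ∃ v : ℝ → ℝ, v 0 = c ∧ ContDiffOn ℝ r v (Ioo (-δ) δ) ∧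
      (∀ u ∈ Ioo (-δ) δ, 0 < A (u, v u)) ∧
      ∀ u ∈ Ioo (-δ) δ, u ≠ 0 → HasDerivAt v (B (u, v u) / (A (u, v u) * u ^ 2)) u := by
  induction r with
  | zero =>
    intro A B c h
    simpa using h.exists_continuous_solution
  | succ r ih =>
    intro A B c h
    -- With two blow-ups, `v = c + c₁ u + u² w₂` and `v' = c₁ + 2 u w₂ + u² w₂'`, where `u² w₂' = B₂
    -- / A₂` by the equation. Thus `v'` is as smooth as `w₂`; after a single blow-up the term `u w'`
    -- would still carry a division by `u`.
    obtain ⟨A₁, B₁, c₁, h₁, eA₁, eB₁⟩ := h.exists_blowUp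
    obtain ⟨A₂, B₂, c₂, h₂, eA₂, eB₂⟩ := h₁.exists_blowUp
    obtain ⟨δ, hδ, w₂, hw0, hwr, hpos, hder⟩ := ih h₂
    have hA : ∀ u, A (u, c + u * (c₁ + u * w₂ u)) = A₂ (u, w₂ u) := fun u => by rw [eA₁, eA₂]
    have hB : ∀ u, B (u, c + u * (c₁ + u * w₂ u)) = u * (u * (B₂ (u, w₂ u)
        + u * w₂ u * A₂ (u, w₂ u)) + u * (c₁ + u * w₂ u) * A₂ (u, w₂ u)) := fun u => by
      rw [eB₁, eB₂, eA₂]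
    let D : ℝ → ℝ := fun u => c₁ + u * w₂ u + u * w₂ u + B₂ (u, w₂ u) / A₂ (u, w₂ u)
    have hD : ∀ u ∈ Ioo (-δ) δ, HasDerivAt (fun u => c + u * (c₁ + u * w₂ u)) (D u) u := by
      intro u hu
      rcases eq_or_ne u 0 with rfl | hu0
      -- At `u = 0` the difference quotient is `c₁ + u w₂ u`, so continuity of `w₂` is enough.
      · have hw : ContinuousAt w₂ 0 := hwr.continuousOn.continuousAt (Ioo_mem_nhds hu.1 hu.2)
        have hw' : ContinuousAt (fun u => c₁ + u * w₂ u) 0 := by fun_prop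
        rw [hasDerivAt_iff_tendsto_slope]
        have hD0 : D 0 = c₁ + 0 * w₂ 0 := by simp [D, hw0, h₂.root]
        rw [hD0]
        refine (hw'.tendsto.mono_left nhdsWithin_le_nhds).congr' ?_
        filter_upwards [self_mem_nhdsWithin] with x hx
        have hx : x ≠ 0 := hx
        rw [slope_def_field]
        field_simp
        ring
      · have h1 := ((hasDerivAt_id u).mul (hder u hu hu0)).const_add c₁
        have h2 := ((hasDerivAt_id u).mul h1).const_add c
        refine h2.congr_deriv ?_
        have := (hpos u hu).ne'
        simp only [D, id, Pi.mul_apply]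
        field_simp
        ring
    refine ⟨δ, hδ, fun u => c + u * (c₁ + u * w₂ u), by simp, ?_, fun u hu => ?_,
      fun u hu hu0 => ?_⟩
    · push_cast
      rw [contDiffOn_succ_iff_deriv_of_isOpen isOpen_Ioo]
      refine ⟨fun u hu => (hD u hu).differentiableAt.differentiableWithinAt, by simp, ?_⟩
      refine ContDiffOn.congr (f := D) ?_ fun u hu => (hD u hu).deriv
      have hp : ContDiffOn ℝ r (fun u => (u, w₂ u)) (Ioo (-δ) δ) := contDiffOn_id.prodMk hwr
      have hq : ContDiffOn ℝ r (fun u => u * w₂ u) (Ioo (-δ) δ) := contDiffOn_id.mul hwr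
      exact ((contDiffOn_const.add hq).add hq).add
        ((h₂.right.contDiff.comp_contDiffOn hp).div (h₂.left.contDiff.comp_contDiffOn hp)
          fun u hu => (hpos u hu).ne')
    · rw [hA]
      exact hpos u hu
    · refine (hD u hu).congr_deriv ?_
      rw [hA, hB]
      have := (hpos u hu).ne'
      simp only [D]
      field_simp
      ring

/-! ### Invariance of graphs tangent to the field. -/

/-- A `C¹` graph along which the vector field is tangent is invariant under the flow. -/
theorem eq_graph_of_tangent {E : Type*} [NormedAddCommGroup E] [NormedSpace ℝ E]
    {F : ℝ × E → ℝ × E} (hF : ContDiff ℝ 1 F) {δ : ℝ} {h h' : ℝ → E}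
    (hd : ∀ x ∈ Ioo (-δ) δ, HasDerivAt h (h' x) x) (hc : ContinuousOn h' (Ioo (-δ) δ))
    (hinv : ∀ x ∈ Ioo (-δ) δ, (F (x, h x)).2 = (F (x, h x)).1 • h' x)
    {a b : ℝ} {z : ℝ → ℝ × E} (ha : a < 0) (hb : 0 < b)
    (hz : IsIntegralCurveOn z (fun _ => F) (Ioo a b)) (h0 : (z 0).2 = h (z 0).1)
    (hδ : ∀ t ∈ Ioo a b, |(z t).1| < δ) : ∀ t ∈ Ioo a b, (z t).2 = h (z t).1 := by
  have hz' : ∀ t ∈ Ioo a b, HasDerivAt z (F (z t)) t := fun t ht =>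
    (hz t ht).hasDerivAt (Ioo_mem_nhds ht.1 ht.2)
  have hx : ∀ t ∈ Ioo a b, (z t).1 ∈ Ioo (-δ) δ := fun t ht => abs_lt.1 (hδ t ht)
  have hz1 : ∀ t ∈ Ioo a b, HasDerivAt (fun t => (z t).1) (F (z t)).1 t := fun t ht =>
    (ContinuousLinearMap.fst ℝ ℝ E).hasFDerivAt.comp_hasDerivAt t (hz' t ht)
  have hz2 : ∀ t ∈ Ioo a b, HasDerivAt (fun t => (z t).2) (F (z t)).2 t := fun t ht =>
    (ContinuousLinearMap.snd ℝ ℝ E).hasFDerivAt.comp_hasDerivAt t (hz' t ht)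
  let d : ℝ → E := fun t => (z t).2 - h (z t).1
  -- The deviation `d` from the graph solves `d' = G t d` with `G t 0 = 0`. Here `h'` is evaluated
  -- along the given solution and not at `e`, so `G` is locally Lipschitz in `e` although `h'` is
  -- merely continuous.
  let G : ℝ → E → E := fun t e =>
    (F ((z t).1, h (z t).1 + e)).2 - (F ((z t).1, h (z t).1 + e)).1 • h' (z t).1
  have hdG : ∀ t ∈ Ioo a b, HasDerivAt d (G t (d t)) t := by
    intro t ht
    refine ((hz2 t ht).sub ((hd _ (hx t ht)).scomp t (hz1 t ht))).congr_deriv ?_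
    simp [G, d]
  have hdc : ∀ t ∈ Ioo a b, ContinuousAt d t := fun t ht => (hdG t ht).continuousAt
  have hloc : ∀ t ∈ Ioo a b, d t = 0 → ∀ᶠ t' in 𝓝 t, d t' = 0 := by
    intro t₀ ht₀ hd0
    obtain ⟨K, V, hV, hK⟩ :=
      (hF.contDiffAt (x := ((z t₀).1, h (z t₀).1))).exists_lipschitzOnWith
    have hzc := (hz1 t₀ ht₀).continuousAt
    have hhc : ContinuousAt (fun t => h (z t).1) t₀ :=
      ContinuousAt.comp (g := h) (hd _ (hx t₀ ht₀)).continuousAt hzc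
    have hh'c : ContinuousAt (fun t => h' (z t).1) t₀ :=
      ContinuousAt.comp (g := h')
        (hc.continuousAt (Ioo_mem_nhds (hx t₀ ht₀).1 (hx t₀ ht₀).2)) hzc
    let M : NNReal := ‖h' (z t₀).1‖₊ + 1
    have hM : ∀ᶠ t in 𝓝 t₀, ‖h' (z t).1‖₊ < M :=
      hh'c.nnnorm.eventually (gt_mem_nhds (lt_add_one _))
    refine ODE_solution_unique_of_eventually (v := G) (K := K + K * M)
      (s := fun t => {e | ((z t).1, h (z t).1 + e) ∈ V}) (g := fun _ => 0) ?_ ?_ ?_ hd0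
    · filter_upwards [hM] with t ht
      refine LipschitzOnWith.of_dist_le_mul fun e he e' he' => ?_
      have hL := hK.dist_le_mul _ he _ he'
      set p := F ((z t).1, h (z t).1 + e)
      set q := F ((z t).1, h (z t).1 + e')
      have hde : dist ((z t).1, h (z t).1 + e) ((z t).1, h (z t).1 + e') = dist e e' := by
        simp [Prod.dist_eq]
      rw [hde] at hL
      have e1 : dist p.1 q.1 ≤ K * dist e e' := (le_max_left _ _).trans hL
      have e2 : dist p.2 q.2 ≤ K * dist e e' := (le_max_right _ _).trans hL
      have ht' : ‖h' (z t).1‖ ≤ M := by exact_mod_cast ht.le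
      have : G t e - G t e' = (p.2 - q.2) - (p.1 - q.1) • h' (z t).1 := by
        simp only [G, sub_smul, p, q]
        abel
      rw [dist_eq_norm, this]
      refine (norm_sub_le _ _).trans ?_
      rw [norm_smul, ← dist_eq_norm, ← dist_eq_norm]
      push_cast
      have := mul_le_mul e1 ht' (norm_nonneg _) (by positivity)
      linarith
    · have hzV : ∀ᶠ t in 𝓝 t₀, z t ∈ V := by
        refine (hz' t₀ ht₀).continuousAt.eventually_mem ?_
        have : z t₀ = ((z t₀).1, h (z t₀).1) := Prod.ext rfl (sub_eq_zero.1 hd0)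
        rwa [this]
      filter_upwards [Ioo_mem_nhds ht₀.1 ht₀.2, hzV] with t ht hV
      exact ⟨hdG t ht, by simpa [d] using hV⟩
    · have hzV : ∀ᶠ t in 𝓝 t₀, ((z t).1, h (z t).1) ∈ V := (hzc.prodMk hhc).eventually_mem hV
      filter_upwards [Ioo_mem_nhds ht₀.1 ht₀.2, hzV] with t ht hV
      refine ⟨?_, by simpa using hV⟩
      have : G t 0 = 0 := by simp [G, hinv _ (hx t ht)]
      rw [this]
      exact hasDerivAt_const t 0
  -- By `hloc` and continuity, the zero set of `d` is open and closed in the interval, which is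
  -- connected.
  have hsub : Ioo a b ⊆ interior {t | d t = 0} := by
    refine isPreconnected_Ioo.subset_of_closure_inter_subset isOpen_interior
      ⟨0, ⟨ha, hb⟩, mem_interior_iff_mem_nhds.2 (hloc 0 ⟨ha, hb⟩ (sub_eq_zero.2 h0))⟩ ?_
    rintro t ⟨htc, ht⟩
    refine mem_interior_iff_mem_nhds.2 (hloc t ht ?_)
    have hcl : t ∈ closure {t | d t = 0} := closure_mono interior_subset htc
    obtain ⟨u, hu, hut⟩ := mem_closure_iff_seq_limit.1 hcl
    have h1 := (hdc t ht).tendsto.comp hut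
    have h2 : d ∘ u = fun _ => 0 := funext hu
    rw [h2] at h1
    exact tendsto_nhds_unique h1 tendsto_const_nhds
  intro t ht
  have h1 : t ∈ {t | d t = 0} := interior_subset (hsub ht)
  exact sub_eq_zero.1 h1

/-! ### Construction of a center manifold in the surface without matter and radiation. -/

theorem contDiff_centerField (γ : ℝ) {n : WithTop ℕ∞} : ContDiff ℝ n (centerField γ) := by
  refine ContDiff.prodMk ?_ (contDiff_pi.2 fun i => ?_)
  · simp only [quadField, fromCenterCoords, Matrix.cons_val]
    fun_prop
  · fin_cases i <;> simp [quadField, fromCenterCoords] <;> fun_prop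

/-- The vector field on the invariant surface `σ₅ = 0`, `σ₂² + σ₄² = 1`. -/
theorem centerField_surface (γ x s w : ℝ) (hw : w ^ 2 = 1 - s ^ 2) :
    centerField γ (x, ![s - x, w - 1, 0]) =
      (-(2 / 3 * x * (1 - 3 / 2 * x) * s),
        ![w ^ 2 * (x - s) + 2 / 3 * x * (1 - 3 / 2 * x) * s, -(w * s * (x - s)), 0]) := by
  refine Prod.ext ?_ (funext fun i => ?_)
  · simp [centerField, toCenterVel, quadField, fromCenterCoords]
    ring
  · fin_cases i
    · simp [centerField, toCenterVel, quadField, fromCenterCoords]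
      linear_combination (s - γ / 2 * s + (3 * γ - 4) / 6) * hw
    · simp [centerField, toCenterVel, quadField, fromCenterCoords]
      linear_combination (-(γ / 2) * w) * hw
    · simp [centerField, toCenterVel, quadField, fromCenterCoords]

/-- The trace of the center manifold on the invariant surface: a curve `σ₂ = x k(x)`. -/
theorem exists_center_profile (r : ℕ) :
    ∃ δ > 0, ∃ k : ℝ → ℝ, k 0 = 1 ∧ ContDiffOn ℝ r k (Ioo (-δ) δ) ∧
      (∀ x ∈ Ioo (-δ) δ, 0 < 2 / 3 * (1 - 3 / 2 * x) * k x ∧ (x * k x) ^ 2 < 1) ∧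
      ∀ x ∈ Ioo (-δ) δ, DifferentiableAt ℝ k x →
        deriv (fun x => x * k x) x * (-(2 / 3 * x * (1 - 3 / 2 * x) * (x * k x)))
          = (1 - (x * k x) ^ 2) * (x - x * k x) := by
  have hA : IsPolyFun fun p : ℝ × ℝ => 2 / 3 * (1 - 3 / 2 * p.1) * p.2 :=
    .mul (.mul (.const _) ((IsPolyFun.const 1).sub (.mul (.const _) .fst))) .snd
  -- Inserting `s = x k` in `(ds/dx) x' = (1 - s²)(x - s)` and cancelling `-x` gives `x² k' A = (1 -
  -- x² k²)(k - 1) - x A k`.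
  have hB : IsPolyFun fun p : ℝ × ℝ => (1 - p.1 * p.2 * (p.1 * p.2)) * (p.2 - 1)
      - p.1 * (2 / 3 * (1 - 3 / 2 * p.1) * p.2) * p.2 :=
    (IsPolyFun.mul ((IsPolyFun.const 1).sub (.mul (.mul .fst .snd) (.mul .fst .snd)))
      (IsPolyFun.sub .snd (.const 1))).sub (.mul (.mul .fst hA) .snd)
  have h : IsSingularEquation _ _ 1 := ⟨hA, hB, by norm_num, by norm_num, 1, one_pos, by
    simpa using (hasDerivAt_id (1 : ℝ)).sub_const 1⟩
  obtain ⟨δ, hδ, k, hk0, hkr, hpos, hder⟩ := h.exists_contDiffOn_solution r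
  have hkc : ContinuousAt k 0 := hkr.continuousOn.continuousAt (Ioo_mem_nhds (by linarith) hδ)
  have hsmall : ∀ᶠ x in 𝓝 (0 : ℝ), (x * k x) ^ 2 < 1 := by
    have : ContinuousAt (fun x => (x * k x) ^ 2) 0 := by fun_prop
    exact this.eventually (gt_mem_nhds (by simp))
  obtain ⟨s, hs, H⟩ := Metric.eventually_nhds_iff.1 hsmall
  have hsub : Ioo (-min δ s) (min δ s) ⊆ Ioo (-δ) δ :=
    Ioo_subset_Ioo (neg_le_neg (min_le_left _ _)) (min_le_left _ _)
  refine ⟨min δ s, by positivity, k, hk0, hkr.mono hsub, fun x hx => ⟨hpos x (hsub hx), ?_⟩,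
    fun x hx hd => ?_⟩
  · exact H (by simpa using (abs_lt.2 hx).trans_le (min_le_right _ _))
  · rcases eq_or_ne x 0 with rfl | hx0
    · simp
    · have h1 := ((hasDerivAt_id x).mul (hder x (hsub hx) hx0)).deriv
      have h2 : (id * k) = fun x => x * k x := rfl
      rw [h2] at h1
      rw [h1]
      have := (hpos x (hsub hx)).ne'
      simp only [id]
      set A := 2 / 3 * (1 - 3 / 2 * x) * k x with hAdef
      have e : 2 / 3 * x * (1 - 3 / 2 * x) * (x * k x) = x ^ 2 * A := by rw [hAdef]; ring
      rw [e]
      field_simp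
      ring

/-- The graph over the center direction determined by a profile `k`. -/
noncomputable def centerGraph (k : ℝ → ℝ) (x : ℝ) : Fin 3 → ℝ :=
  ![x * k x - x, √(1 - (x * k x) ^ 2) - 1, 0]

theorem hasDerivAt_centerGraph {k : ℝ → ℝ} {x : ℝ} (hd : DifferentiableAt ℝ k x)
    (hx : (x * k x) ^ 2 < 1) :
    HasDerivAt (centerGraph k) ![deriv (fun x => x * k x) x - 1,
      -(x * k x) * deriv (fun x => x * k x) x / √(1 - (x * k x) ^ 2), 0] x := by
  have hs : HasDerivAt (fun x => x * k x) (deriv (fun x => x * k x) x) x :=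
    (differentiableAt_id.mul hd).hasDerivAt
  set D := deriv (fun x => x * k x) x
  rw [hasDerivAt_pi]
  intro i
  fin_cases i
  · exact hs.sub (hasDerivAt_id x)
  · have h1 := ((hs.pow 2).const_sub 1).sqrt (sub_pos.2 hx).ne'
    have h2 := h1.sub_const 1
    refine h2.congr_deriv ?_
    simp
    field_simp
  · simpa [centerGraph] using hasDerivAt_const x (0 : ℝ)

theorem centerField_centerGraph (γ : ℝ) {k : ℝ → ℝ} {x : ℝ} (hx : (x * k x) ^ 2 < 1) :
    centerField γ (x, centerGraph k x) = (-(2 / 3 * x * (1 - 3 / 2 * x) * (x * k x)),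
        ![(1 - (x * k x) ^ 2) * (x - x * k x) + 2 / 3 * x * (1 - 3 / 2 * x) * (x * k x),
          -(√(1 - (x * k x) ^ 2) * (x * k x) * (x - x * k x)), 0]) := by
  have hw : √(1 - (x * k x) ^ 2) ^ 2 = 1 - (x * k x) ^ 2 := Real.sq_sqrt (sub_pos.2 hx).le
  rw [centerGraph, centerField_surface γ x _ _ hw, hw]

/-- The first component is the profile equation. The second follows from it because graph and field
both respect `σ₂² + σ₄² = 1`. -/
theorem centerField_tangent_centerGraph (γ : ℝ) {k : ℝ → ℝ} {x : ℝ} (hx : (x * k x) ^ 2 < 1)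
    (hk : deriv (fun x => x * k x) x * (-(2 / 3 * x * (1 - 3 / 2 * x) * (x * k x)))
          = (1 - (x * k x) ^ 2) * (x - x * k x)) :
    (centerField γ (x, centerGraph k x)).2 = (centerField γ (x, centerGraph k x)).1 •
      ![deriv (fun x => x * k x) x - 1,
        -(x * k x) * deriv (fun x => x * k x) x / √(1 - (x * k x) ^ 2), 0] := by
  rw [centerField_centerGraph γ hx]
  have hw : √(1 - (x * k x) ^ 2) ^ 2 = 1 - (x * k x) ^ 2 := Real.sq_sqrt (sub_pos.2 hx).le
  have hw0 : √(1 - (x * k x) ^ 2) ≠ 0 := (Real.sqrt_pos.2 (sub_pos.2 hx)).ne'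
  set w := √(1 - (x * k x) ^ 2)
  set D := deriv (fun x => x * k x) x
  funext i
  fin_cases i
  · simp
    linear_combination -hk
  · simp
    rw [← hw] at hk
    field_simp
    linear_combination (-3 * k x * x) * hk
  · simp

theorem exists_isLocalCenterManifold (γ : ℝ) (r : ℕ) :
    ∃ (δ : ℝ) (h : ℝ → (Fin 3 → ℝ)), IsLocalCenterManifold (centerField γ) r δ h := by
  -- Class `r + 1` is requested so that the graph has a continuous derivative even when `r = 0`, as
  -- the invariance argument requires.
  obtain ⟨δ, hδ, k, hk0, hkr, hpos, hder⟩ := exists_center_profile (r + 1)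
  have hkd : ∀ x ∈ Ioo (-δ) δ, DifferentiableAt ℝ k x := fun x hx =>
    (hkr.differentiableOn (by simp)).differentiableAt (Ioo_mem_nhds hx.1 hx.2)
  have hs : ContDiffOn ℝ (r + 1 : ℕ) (fun x => x * k x) (Ioo (-δ) δ) := contDiffOn_id.mul hkr
  have hD : ContinuousOn (deriv fun x => x * k x) (Ioo (-δ) δ) :=
    hs.continuousOn_deriv_of_isOpen isOpen_Ioo (by simp)
  have hw : ∀ x ∈ Ioo (-δ) δ, 1 - (x * k x) ^ 2 ≠ 0 := fun x hx => (sub_pos.2 (hpos x hx).2).ne'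
  have h0 : (0 : ℝ) ∈ Ioo (-δ) δ := ⟨by linarith, hδ⟩
  refine ⟨δ, centerGraph k, hδ, ?_, ?_, ?_, ?_⟩
  · have hs' : ContDiffOn ℝ r (fun x => x * k x) (Ioo (-δ) δ) := hs.of_le (by simp)
    refine contDiffOn_pi.2 fun i => ?_
    fin_cases i
    · exact hs'.sub contDiffOn_id
    · exact ((contDiffOn_const.sub (hs'.pow 2)).sqrt hw).sub contDiffOn_const
    · exact contDiffOn_const
  · funext i
    fin_cases i <;> simp [centerGraph]
  · refine (hasDerivAt_centerGraph (hkd 0 h0) (hpos 0 h0).2).congr_deriv ?_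
    have : deriv (fun x => x * k x) 0 = 1 := by
      have := ((hasDerivAt_id (0 : ℝ)).mul (hkd 0 h0).hasDerivAt).deriv
      have h2 : (id * k) = fun x => x * k x := rfl
      rw [h2] at this
      simp [this, hk0]
    funext i
    fin_cases i <;> simp [this]
  · intro a b z ha hb hz hz0 hzδ
    refine eq_graph_of_tangent (contDiff_centerField γ)
      (fun x hx => hasDerivAt_centerGraph (hkd x hx) (hpos x hx).2) ?_
      (fun x hx => centerField_tangent_centerGraph γ (hpos x hx).2 (hder x hx (hkd x hx)))
      ha hb hz hz0 hzδ
    have hsc := hs.continuousOn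
    refine continuousOn_pi.2 fun i => ?_
    fin_cases i
    · exact hD.sub continuousOn_const
    · exact (hsc.neg.mul hD).div (continuousOn_const.sub (hsc.pow 2)).sqrt
        fun x hx => (Real.sqrt_pos.2 (sub_pos.2 (hpos x hx).2)).ne'
    · exact continuousOn_const

/-! ### Center form and the reduced flow. -/

/-- The `x`-component of the field in center coordinates, of second order at the origin. -/
noncomputable def centerDrift (p : ℝ × (Fin 3 → ℝ)) : ℝ :=
  p.1 * (p.1 + p.2 0) * (-(2 / 3) * (1 - 3 / 2 * p.1))

/-- The nonlinear part of the `y`-component of the field in center coordinates. -/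
noncomputable def centerRemainder (γ : ℝ) (p : ℝ × (Fin 3 → ℝ)) : Fin 3 → ℝ :=
  ![p.1 * p.2 1 * (2 + p.2 1)
      + (p.1 + p.2 0) * (p.1 + p.2 0) * ((1 - γ / 2) * (p.1 + p.2 0) + (3 * γ - 4) / 6)
      + p.2 2 * p.2 2 * ((3 * γ - 4) / 6 + (4 - 3 * γ) / 6 * (p.1 + p.2 0))
      + p.2 1 * p.2 1 * ((3 * γ - 4) / 6)
      + (p.1 + p.2 0) * p.2 1 * (-γ - γ / 2 * p.2 1) - centerDrift p,
    p.1 * (p.1 + p.2 0) * (-(1 + p.2 1))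
      + (p.1 + p.2 0) * (p.1 + p.2 0) * ((1 - γ / 2) * (1 + p.2 1))
      + p.2 1 * p.2 1 * (-(γ / 2) * (3 + p.2 1))
      + p.2 2 * p.2 2 * ((4 - 3 * γ) / 6 * (1 + p.2 1)),
    (p.1 + p.2 0) * (p.1 + p.2 0) * ((1 - γ / 2) * p.2 2)
      + p.2 1 * p.2 2 * (-(γ / 2) * (2 + p.2 1))
      + p.2 2 * p.2 2 * ((4 - 3 * γ) / 6 * p.2 2)]

theorem centerField_eq (γ : ℝ) (p : ℝ × (Fin 3 → ℝ)) :
    centerField γ p = (centerDrift p, (centerBlock γ).mulVec p.2 + centerRemainder γ p) := by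
  obtain ⟨x, y⟩ := p
  refine Prod.ext ?_ (funext fun i => ?_)
  · simp [centerField, toCenterVel, quadField, fromCenterCoords, centerDrift]
    ring
  · fin_cases i <;>
    · simp [centerField, toCenterVel, quadField, fromCenterCoords, centerDrift, centerRemainder,
        centerBlock, dotProduct, Fin.sum_univ_three]
      ring

/-- All terms of `centerDrift` and `centerRemainder` have this shape: two factors of first order
times a continuous one. -/
theorem IsBigO.mul_mul_continuous {E : Type*} [NormedAddCommGroup E] {f g e : E → ℝ}
    (hf : f =O[𝓝 0] fun p => ‖p‖) (hg : g =O[𝓝 0] fun p => ‖p‖) (he : Continuous e) :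
    (fun p => f p * g p * e p) =O[𝓝 0] fun p => ‖p‖ ^ 2 := by
  have h := (hf.mul hg).mul (he.continuousAt.tendsto.isBigO_one ℝ)
  simpa [sq] using h

theorem isBigO_fst : (fun p : ℝ × (Fin 3 → ℝ) => p.1) =O[𝓝 0] fun p => ‖p‖ :=
  IsBigO.of_norm_le fun p => norm_fst_le p

theorem isBigO_snd_apply (i : Fin 3) :
    (fun p : ℝ × (Fin 3 → ℝ) => p.2 i) =O[𝓝 0] fun p => ‖p‖ :=
  IsBigO.of_norm_le fun p => (norm_le_pi_norm p.2 i).trans (norm_snd_le p)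

theorem centerDrift_isBigO : centerDrift =O[𝓝 0] fun p => ‖p‖ ^ 2 :=
  IsBigO.mul_mul_continuous isBigO_fst (isBigO_fst.add (isBigO_snd_apply 0)) (by fun_prop)

theorem centerRemainder_isBigO (γ : ℝ) : centerRemainder γ =O[𝓝 0] fun p => ‖p‖ ^ 2 := by
  have hx := isBigO_fst
  have hb := isBigO_snd_apply 1
  have hc := isBigO_snd_apply 2
  have hs := isBigO_fst.add (isBigO_snd_apply 0)
  rw [isBigO_pi]
  intro i
  fin_cases i
  · exact (((((IsBigO.mul_mul_continuous hx hb (by fun_prop)).add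
      (IsBigO.mul_mul_continuous hs hs (by fun_prop))).add
      (IsBigO.mul_mul_continuous hc hc (by fun_prop))).add
      (IsBigO.mul_mul_continuous hb hb (by fun_prop))).add
      (IsBigO.mul_mul_continuous hs hb (by fun_prop))).sub centerDrift_isBigO
  · exact (((IsBigO.mul_mul_continuous hx hs (by fun_prop)).add
      (IsBigO.mul_mul_continuous hs hs (by fun_prop))).add
      (IsBigO.mul_mul_continuous hb hb (by fun_prop))).add
      (IsBigO.mul_mul_continuous hc hc (by fun_prop))
  · exact ((IsBigO.mul_mul_continuous hs hs (by fun_prop)).add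
      (IsBigO.mul_mul_continuous hb hc (by fun_prop))).add
      (IsBigO.mul_mul_continuous hc hc (by fun_prop))

theorem isCenterForm_centerField {γ : ℝ} (hγ : 0 < γ) :
    IsCenterForm (centerField γ) (centerBlock γ) := by
  refine ⟨⟨centerDrift, centerRemainder γ, centerField_eq γ, by simp [centerDrift], ?_, ?_, ?_⟩,
    fun μ hμ => ?_⟩
  · funext i
    fin_cases i <;> simp [centerRemainder, centerDrift]
  · exact IsBigO.hasFDerivAt (n := 2) (by simpa using centerDrift_isBigO) one_lt_two
  · exact IsBigO.hasFDerivAt (n := 2) (by simpa using centerRemainder_isBigO γ) one_lt_two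
  · rw [spectrum.mem_iff, Matrix.isUnit_iff_isUnit_det, isUnit_iff_ne_zero, not_not,
      Matrix.det_fin_three] at hμ
    simp [centerBlock, Matrix.algebraMap_matrix_apply] at hμ
    rcases hμ with (h | h) | h
    · rw [eq_neg_of_add_eq_zero_left h]
      simp
    · rw [eq_neg_of_add_eq_zero_left h]
      simpa using hγ
    · rw [eq_neg_of_add_eq_zero_left h]
      norm_num

/-- On a local center manifold the vector field is tangent to the graph. -/
theorem IsLocalCenterManifold.tangent_field {s r : ℕ} {F : ℝ × (Fin s → ℝ) → ℝ × (Fin s → ℝ)}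
    {δ : ℝ} {h : ℝ → (Fin s → ℝ)} (H : IsLocalCenterManifold F r δ h) (hr : 1 ≤ r)
    (hF : ContDiff ℝ 1 F) {x : ℝ} (hx : x ∈ Ioo (-δ) δ) :
    (F (x, h x)).2 = (F (x, h x)).1 • deriv h x := by
  have hd : HasDerivAt h (deriv h x) x :=
    ((H.contDiffOn.differentiableOn (by
      exact_mod_cast (Nat.one_le_iff_ne_zero.1 hr))).differentiableAt
      (Ioo_mem_nhds hx.1 hx.2)).hasDerivAt
  -- A local solution through a point of the graph stays on it; comparing derivatives at time zero
  -- gives tangency.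
  obtain ⟨z, hz0, ε, hε, hz⟩ :=
    (hF.contDiffAt (x := (x, h x))).exists_forall_mem_closedBall_exists_eq_forall_mem_Ioo_hasDerivAt₀
      0
  rw [zero_sub, zero_add] at hz
  have hd0 : HasDerivAt z (F (x, h x)) 0 := by
    have := hz 0 ⟨by linarith, hε⟩
    rwa [hz0] at this
  have h1 : HasDerivAt (fun t => (z t).1) (F (x, h x)).1 0 :=
    (ContinuousLinearMap.fst ℝ ℝ (Fin s → ℝ)).hasFDerivAt.comp_hasDerivAt 0 hd0
  have h2 : HasDerivAt (fun t => (z t).2) (F (x, h x)).2 0 :=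
    (ContinuousLinearMap.snd ℝ ℝ (Fin s → ℝ)).hasFDerivAt.comp_hasDerivAt 0 hd0
  have hsmall : ∀ᶠ t in 𝓝 (0 : ℝ), |(z t).1| < δ := by
    refine h1.continuousAt.abs.eventually (gt_mem_nhds ?_)
    simpa [hz0] using abs_lt.2 hx
  obtain ⟨η, hη, hball⟩ := Metric.eventually_nhds_iff.1 hsmall
  have hsub : Ioo (-min ε η) (min ε η) ⊆ Ioo (-ε) ε :=
    Ioo_subset_Ioo (neg_le_neg (min_le_left _ _)) (min_le_left _ _)
  have hm : 0 < min ε η := lt_min hε hη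
  have key := H.invariant (-min ε η) (min ε η) z (neg_lt_zero.2 hm) hm
    (fun t ht => (hz t (hsub ht)).hasDerivWithinAt) (by rw [hz0])
    (fun t ht => hball (by simpa using (abs_lt.2 ht).trans_le (min_le_right _ _)))
  have h3 : HasDerivAt (fun t => h (z t).1) ((F (x, h x)).1 • deriv h x) 0 := by
    refine HasDerivAt.scomp (0 : ℝ) (h := fun t => (z t).1) ?_ h1
    rwa [hz0]
  refine h2.unique (h3.congr_of_eventuallyEq ?_)
  filter_upwards [Ioo_mem_nhds (neg_lt_zero.2 hm) hm] with t ht using key t ht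

/-- Tangency reads `B h = f h' - g` along the graph, which is `O(x²)` since `h = O(x)` and `h'` is
bounded. The first two rows of `B` are triangular and invertible, so `h₁`, then `h₀`, are `O(x²)`.
Only `h₀` enters the drift, where it contributes `O(x³)`. -/
theorem IsLocalCenterManifold.flow_isBigO {γ : ℝ} (hγ : 0 < γ) {r : ℕ} {δ : ℝ}
    {h : ℝ → (Fin 3 → ℝ)} (hr : 1 ≤ r) (H : IsLocalCenterManifold (centerField γ) r δ h) :
    (fun x : ℝ => (centerField γ (x, h x)).1 - (-(2 / 3) * x ^ 2)) =O[𝓝 0] fun x => x ^ 3 := by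
  have hδ := H.pos
  have h0 : (0 : ℝ) ∈ Ioo (-δ) δ := ⟨by linarith, hδ⟩
  have hnhds : Ioo (-δ) δ ∈ 𝓝 (0 : ℝ) := Ioo_mem_nhds h0.1 h0.2
  have hh : h =O[𝓝 0] fun x => x := by
    have := H.tangent.hasFDerivAt.isBigO_sub
    simpa [H.map_zero] using this
  have hp : (fun x => (x, h x)) =O[𝓝 0] fun x : ℝ => x := (isBigO_refl _ _).prod_left hh
  have hpt : Tendsto (fun x => (x, h x)) (𝓝 0) (𝓝 (0 : ℝ × (Fin 3 → ℝ))) :=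
    hp.trans_tendsto tendsto_id
  have hp2 : (fun x => ‖((x, h x) : ℝ × (Fin 3 → ℝ))‖ ^ 2) =O[𝓝 0] fun x : ℝ => x ^ 2 :=
    hp.norm_left.pow 2
  have hf : (fun x => centerDrift (x, h x)) =O[𝓝 0] fun x : ℝ => x ^ 2 :=
    (centerDrift_isBigO.comp_tendsto hpt).trans hp2
  have hR : (fun x => centerRemainder γ (x, h x)) =O[𝓝 0] fun x : ℝ => x ^ 2 :=
    ((centerRemainder_isBigO γ).comp_tendsto hpt).trans hp2
  have hD : deriv h =O[𝓝 0] fun _ : ℝ => (1 : ℝ) := by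
    have : ContinuousOn (deriv h) (Ioo (-δ) δ) :=
      H.contDiffOn.continuousOn_deriv_of_isOpen isOpen_Ioo (by exact_mod_cast hr)
    exact (this.continuousAt hnhds).tendsto.isBigO_one ℝ
  have hB : (fun x => (centerBlock γ).mulVec (h x)) =O[𝓝 0] fun x : ℝ => x ^ 2 := by
    have h1 : (fun x => centerDrift (x, h x) • deriv h x - centerRemainder γ (x, h x))
        =O[𝓝 0] fun x : ℝ => x ^ 2 := by
      refine IsBigO.sub ?_ hR
      simpa using hf.smul hD
    refine h1.congr' ?_ EventuallyEq.rfl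
    filter_upwards [hnhds] with x hx
    have := H.tangent_field hr (contDiff_centerField γ) hx
    rw [centerField_eq] at this
    simp only at this
    rw [← this, add_sub_cancel_right]
  rw [isBigO_pi] at hB
  have hb : (fun x => h x 1) =O[𝓝 0] fun x : ℝ => x ^ 2 := by
    have := (hB 1).const_mul_left (-(1 / γ))
    refine this.congr_left fun x => ?_
    simp [centerBlock, Matrix.mulVec, dotProduct, Fin.sum_univ_three]
    field_simp
  have ha : (fun x => h x 0) =O[𝓝 0] fun x : ℝ => x ^ 2 := by
    have := (hb.const_mul_left (γ - 4 / 3)).sub (hB 0)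
    refine this.congr_left fun x => ?_
    simp [centerBlock, Matrix.mulVec, dotProduct, Fin.sum_univ_three]
  have hc : Continuous fun x : ℝ => -(2 / 3) * (1 - 3 / 2 * x) := by fun_prop
  have h3 := ((isBigO_refl (fun x : ℝ => x) (𝓝 0)).mul ha).mul
    (hc.continuousAt.tendsto.isBigO_one ℝ)
  have h4 : (fun x : ℝ => x * h x 0 * (-(2 / 3) * (1 - 3 / 2 * x))) =O[𝓝 0] fun x : ℝ => x ^ 3 :=
    h3.congr_right fun x => by ring
  refine (h4.add (isBigO_refl _ _)).congr_left fun x => ?_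
  rw [centerField_eq]
  simp only [centerDrift]
  ring

/-! ### Instability, and solutions leaving and approaching the de Sitter point. -/

/-- Time translates of the solution emanating from `q` start arbitrarily near `q` and all reach the
same point `z 0 ≠ q`. -/
theorem not_isLyapunovStableOn_of_isSaddleOn {E : Type*} [NormedAddCommGroup E] [NormedSpace ℝ E]
    {X : E → E} {S : Set E} {q : E} (h : IsSaddleOn X S q) : ¬ IsLyapunovStableOn X S q := by
  obtain ⟨-, -, z, hz, hS, h0, hlim⟩ := h
  intro H
  obtain ⟨δ, hδ, H⟩ := H (dist (z 0) q) (dist_pos.2 h0)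
  obtain ⟨t, ht, ht0⟩ := ((hlim.eventually (Metric.ball_mem_nhds q hδ)).and
    (eventually_le_atBot 0)).exists
  have hmem : ∀ s ∈ Icc 0 (-t), s + t ∈ Iic (0 : ℝ) := fun s hs => by
    have := hs.2
    simp only [mem_Iic]
    linarith
  have := H (-t) (fun s => z (s + t)) (fun s hs => ?_) (fun s hs => hS _ (hmem s hs))
    (by simpa using ht) (-t) ⟨by linarith, le_rfl⟩
  · simp at this
  · have h1 : HasDerivWithinAt (fun s => s + t) 1 (Icc 0 (-t)) s :=
      (hasDerivWithinAt_id _ _).add_const t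
    have h2 := HasDerivWithinAt.scomp s (hz (s + t) (hmem s hs)) h1 hmem
    rwa [one_smul] at h2

theorem IsSaddleOn.mono {E : Type*} [NormedAddCommGroup E] [NormedSpace ℝ E]
    {X : E → E} {S S' : Set E} {q : E} (h : IsSaddleOn X S q) (hS : S ⊆ S') :
    IsSaddleOn X S' q := by
  obtain ⟨hq, ⟨z, hz, hzS, hz0, hzl⟩, ⟨w, hw, hwS, hw0, hwl⟩⟩ := h
  exact ⟨hq, ⟨z, hz, fun t ht => hS (hzS t ht), hz0, hzl⟩,
    ⟨w, hw, fun t ht => hS (hwS t ht), hw0, hwl⟩⟩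

/-- The autonomous scalar equation `S' = G(S)` with continuous `0 < G ≤ M` has a global increasing
solution, which tends to `+∞`. -/
theorem exists_global_solution {G : ℝ → ℝ} {M : ℝ} (hG : Continuous G) (hpos : ∀ s, 0 < G s)
    (hM : ∀ s, G s ≤ M) (s₀ : ℝ) :
    ∃ S : ℝ → ℝ, S 0 = s₀ ∧ (∀ t, HasDerivAt S (G (S t)) t) ∧ StrictMono S ∧
      Tendsto S atTop atTop := by
  have hM0 : 0 < M := (hpos 0).trans_le (hM 0)
  -- `Θ s` is the time needed to go from `s₀` to `s`. Since `G ≤ M`, it grows at rate at least `1 /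
  -- M`, hence is onto, and the solution is its inverse.
  let Θ : ℝ → ℝ := fun s => ∫ x in s₀..s, (G x)⁻¹
  have hc : Continuous fun x => (G x)⁻¹ := hG.inv₀ fun x => (hpos x).ne'
  have hΘ : ∀ s, HasDerivAt Θ (G s)⁻¹ s := fun s =>
    intervalIntegral.integral_hasDerivAt_right (hc.intervalIntegrable _ _)
      hc.stronglyMeasurable.stronglyMeasurableAtFilter hc.continuousAt
  have hmono : StrictMono Θ := strictMono_of_deriv_pos fun s => by
    rw [(hΘ s).deriv]
    exact inv_pos.2 (hpos s)
  have hlin : Monotone fun s => Θ s - s / M := by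
    have hd : ∀ s, HasDerivAt (fun s => Θ s - s / M) ((G s)⁻¹ - 1 / M) s := fun s =>
      (hΘ s).sub ((hasDerivAt_id s).div_const M)
    refine monotone_of_deriv_nonneg (fun s => (hd s).differentiableAt) fun s => ?_
    rw [(hd s).deriv, one_div, sub_nonneg]
    exact inv_anti₀ (hpos s) (hM s)
  have htop : Tendsto Θ atTop atTop := by
    have h1 : Tendsto (fun s => s / M + (Θ 0 - 0 / M)) atTop atTop :=
      tendsto_atTop_add_const_right _ _ (tendsto_id.atTop_div_const hM0)
    refine tendsto_atTop_mono' _ ?_ h1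
    filter_upwards [eventually_ge_atTop 0] with s hs
    have := hlin hs
    simp only at this
    linarith
  have hbot : Tendsto Θ atBot atBot := by
    have h1 : Tendsto (fun s => s / M + (Θ 0 - 0 / M)) atBot atBot :=
      tendsto_atBot_add_const_right _ _ (tendsto_id.atBot_div_const hM0)
    refine tendsto_atBot_mono' _ ?_ h1
    filter_upwards [eventually_le_atBot 0] with s hs
    have := hlin hs
    simp only at this
    linarith
  have hcont : Continuous Θ := continuous_iff_continuousAt.2 fun s => (hΘ s).continuousAt
  let e := hmono.orderIsoOfSurjective Θ (hcont.surjective htop hbot)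
  have he : ∀ t, Θ (e.symm t) = t := fun t => e.apply_symm_apply t
  refine ⟨e.symm, ?_, fun t => ?_, e.symm.strictMono, e.symm.tendsto_atTop⟩
  · apply hmono.injective
    rw [he]
    simp [Θ]
  · have := HasDerivAt.of_local_left_inverse (f := Θ) (g := e.symm) (a := t)
      e.symm.continuous.continuousAt (hΘ _) (inv_pos.2 (hpos _)).ne' (Eventually.of_forall he)
    rwa [inv_inv] at this

theorem hasDerivAt_fromCenterCoords {γ : ℝ} {p : ℝ → ℝ × (Fin 3 → ℝ)} {t : ℝ}
    (hp : HasDerivAt p (centerField γ (p t)) t) :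
    HasDerivAt (fun t => fromCenterCoords (p t)) (quadField γ (fromCenterCoords (p t))) t := by
  have h1 : HasDerivAt (fun t => (p t).1) (centerField γ (p t)).1 t :=
    (ContinuousLinearMap.fst ℝ ℝ (Fin 3 → ℝ)).hasFDerivAt.comp_hasDerivAt t hp
  have h2 : HasDerivAt (fun t => (p t).2) (centerField γ (p t)).2 t :=
    (ContinuousLinearMap.snd ℝ ℝ (Fin 3 → ℝ)).hasFDerivAt.comp_hasDerivAt t hp
  rw [hasDerivAt_pi] at h2
  set w := quadField γ (fromCenterCoords (p t)) with hw
  have e : centerField γ (p t) = toCenterVel w := rfl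
  rw [e] at h1 h2
  rw [hasDerivAt_pi]
  intro i
  fin_cases i
  · refine (h1.const_mul (3 / 2)).congr_deriv ?_
    simp [toCenterVel]
    ring
  · refine (h1.add (h2 0)).congr_deriv ?_
    simp [toCenterVel]
  · exact (h2 1).const_add 1
  · exact h2 2

theorem continuous_fromCenterCoords : Continuous fromCenterCoords := by
  refine continuous_pi fun i => ?_
  fin_cases i <;> simp [fromCenterCoords] <;> fun_prop

theorem fromCenterCoords_zero : fromCenterCoords 0 = deSitter := by
  funext i
  fin_cases i <;> simp [fromCenterCoords, deSitter]

theorem quadField_deSitter (γ : ℝ) : quadField γ deSitter = 0 := by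
  funext i
  fin_cases i <;> simp [quadField, deSitter] <;> ring

/-- The solution leaving the de Sitter point along the center manifold. -/
theorem exists_solution_from_deSitter (γ : ℝ) {c : ℝ} (hc : c < 0) :
    ∃ z : ℝ → Fin 4 → ℝ, IsIntegralCurveOn z (fun _ => quadField γ) (Iic 0) ∧
      (∀ t ∈ Iic (0 : ℝ), c ≤ z t 0 ∧ z t 0 ≤ 0 ∧ z t 1 ^ 2 + z t 2 ^ 2 + z t 3 ^ 2 ≤ 1 ∧
        0 ≤ z t 2 ∧ 0 ≤ z t 3) ∧
      z 0 ≠ deSitter ∧ Tendsto z atBot (𝓝 deSitter) := by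
  obtain ⟨δ, hδ, k, hk0, hkr, hpos, hder⟩ := exists_center_profile 1
  have hkd : ∀ x ∈ Ioo (-δ) δ, DifferentiableAt ℝ k x := fun x hx =>
    (hkr.differentiableOn (by simp)).differentiableAt (Ioo_mem_nhds hx.1 hx.2)
  -- The second bound keeps `u = 3 x / 2 ≥ 3 c / 4 ≥ c` for `x ≥ -x₁`.
  set x₁ := min (δ / 2) (-c / 2) with hx₁
  have hx₁0 : 0 < x₁ := lt_min (by linarith) (by linarith)
  have hx₁δ : x₁ < δ := (min_le_left _ _).trans_lt (by linarith)
  have hx₁c : x₁ ≤ -c / 2 := min_le_right _ _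
  have hIcc : Icc (-x₁) 0 ⊆ Ioo (-δ) δ := fun x hx => ⟨by linarith [hx.1], by linarith [hx.2]⟩
  let g : ℝ → ℝ := fun x => 2 / 3 * (1 - 3 / 2 * x) * k x
  have hgc : ContinuousOn g (Icc (-x₁) 0) := by
    have := hkr.continuousOn.mono hIcc
    fun_prop
  obtain ⟨M, hM⟩ := (isCompact_Icc.image_of_continuousOn hgc).bddAbove
  -- On the graph `x' = -x² g(x)`, so `S = -1/x` satisfies `S' = g(-1/S)` in reversed time. Freezing
  -- the argument below `x₁⁻¹` makes the right side positive and bounded on the whole line.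
  let G : ℝ → ℝ := fun s => g (-(max s x₁⁻¹)⁻¹)
  have hs0 : 0 < x₁⁻¹ := inv_pos.2 hx₁0
  have hmem : ∀ s : ℝ, -(max s x₁⁻¹)⁻¹ ∈ Icc (-x₁) 0 := fun s => by
    have h1 : 0 < max s x₁⁻¹ := lt_max_of_lt_right hs0
    refine ⟨neg_le_neg ?_, neg_nonpos.2 (inv_pos.2 h1).le⟩
    exact inv_le_of_inv_le₀ hx₁0 (le_max_right _ _)
  have hGc : Continuous G := by
    refine hgc.comp_continuous (Continuous.neg (Continuous.inv₀ (by fun_prop) fun s => ?_)) hmem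
    exact (lt_max_of_lt_right hs0).ne'
  obtain ⟨S, hS0, hSd, hSm, hSt⟩ := exists_global_solution hGc
    (fun s => (hpos _ (hIcc (hmem s))).1) (fun s => hM (mem_image_of_mem g (hmem s))) x₁⁻¹
  have hSge : ∀ t, t ≤ 0 → x₁⁻¹ ≤ S (-t) := fun t ht => by
    rw [← hS0]
    exact hSm.monotone (by linarith)
  let x : ℝ → ℝ := fun t => -(S (-t))⁻¹
  have hxmem : ∀ t, t ≤ 0 → x t ∈ Icc (-x₁) 0 := fun t ht => by
    have := hmem (S (-t))
    rwa [max_eq_left (hSge t ht)] at this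
  have hxd : ∀ t, t ≤ 0 →
      HasDerivAt x (-(2 / 3 * x t * (1 - 3 / 2 * x t) * (x t * k (x t)))) t := by
    intro t ht
    have hp : 0 < S (-t) := hs0.trans_le (hSge t ht)
    have h1 : HasDerivAt (fun t => S (-t)) (G (S (-t)) * -1) t :=
      (hSd (-t)).comp t (hasDerivAt_neg t)
    refine (h1.inv hp.ne').neg.congr_deriv ?_
    have hG : G (S (-t)) = g (x t) := by simp only [G, x, max_eq_left (hSge t ht)]
    rw [hG]
    simp only [g]
    have : x t = -(S (-t))⁻¹ := rfl
    generalize k (x t) = κ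
    rw [this]
    field_simp
  have hxlim : Tendsto x atBot (𝓝 0) := by
    have h1 : Tendsto (fun t => S (-t)) atBot atTop := hSt.comp tendsto_neg_atBot_atTop
    simpa using (tendsto_inv_atTop_zero.comp h1).neg
  let p : ℝ → ℝ × (Fin 3 → ℝ) := fun t => (x t, centerGraph k (x t))
  have hpd : ∀ t, t ≤ 0 → HasDerivAt p (centerField γ (p t)) t := by
    intro t ht
    have hx := hIcc (hxmem t ht)
    have h1 := hxd t ht
    have h2 := hasDerivAt_centerGraph (hkd _ hx) (hpos _ hx).2
    have h3 := centerField_tangent_centerGraph γ (hpos _ hx).2 (hder _ hx (hkd _ hx))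
    refine (h1.prodMk (h2.scomp t h1)).congr_deriv ?_
    have h4 : (centerField γ (p t)).1 = -(2 / 3 * x t * (1 - 3 / 2 * x t) * (x t * k (x t))) := by
      rw [centerField_centerGraph γ (hpos _ hx).2]
    refine Prod.ext h4.symm ?_
    rw [h3, ← h4]
  refine ⟨fun t => fromCenterCoords (p t), fun t ht =>
    (hasDerivAt_fromCenterCoords (hpd t ht)).hasDerivWithinAt, fun t ht => ?_, fun h => ?_, ?_⟩
  · have hx := hxmem t ht
    have hsq := (hpos _ (hIcc hx)).2
    have hw := Real.sq_sqrt (sub_pos.2 hsq).le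
    refine ⟨?_, ?_, ?_, ?_, ?_⟩
    · simp only [fromCenterCoords, Matrix.cons_val, p]
      linarith [hx.1]
    · simp only [fromCenterCoords, Matrix.cons_val, p]
      linarith [hx.2]
    · simp only [fromCenterCoords, Matrix.cons_val, p, centerGraph, add_sub_cancel, hw]
      apply le_of_eq
      ring
    · simp only [fromCenterCoords, Matrix.cons_val, p, centerGraph, add_sub_cancel]
      positivity
    · simp [fromCenterCoords, p, centerGraph]
  · have h0 := congrFun h 0
    simp [fromCenterCoords, p, deSitter, x, hS0, hx₁0.ne'] at h0
  · have h0 : (0 : ℝ) ∈ Ioo (-δ) δ := ⟨by linarith, hδ⟩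
    have h1 := (hasDerivAt_centerGraph (hkd 0 h0) (hpos 0 h0).2).continuousAt
    have h2 : centerGraph k 0 = 0 := by
      funext i
      fin_cases i <;> simp [centerGraph]
    have h3 : Tendsto p atBot (𝓝 (0, 0)) := by
      have := h1.tendsto.comp hxlim
      rw [h2] at this
      exact hxlim.prodMk_nhds this
    have := (continuous_fromCenterCoords.tendsto (0, 0)).comp h3
    rwa [show ((0 : ℝ), (0 : Fin 3 → ℝ)) = 0 from rfl, fromCenterCoords_zero] at this

/-- The radiation solution that tends to the de Sitter point. -/
theorem exists_solution_to_deSitter (γ : ℝ) :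
    ∃ z : ℝ → Fin 4 → ℝ, IsIntegralCurveOn z (fun _ => quadField γ) (Ici 0) ∧
      (∀ t, z t 0 = 0 ∧ z t 1 ^ 2 + z t 2 ^ 2 + z t 3 ^ 2 ≤ 1 ∧ 0 ≤ z t 2 ∧ 0 ≤ z t 3) ∧
      z 0 ≠ deSitter ∧ Tendsto z atTop (𝓝 deSitter) := by
  -- On `u = σ₂ = 0` the ratio `σ₅ / σ₄` decays with rate `2/3`; the circle `σ₄² + σ₅² = 1` (no
  -- matter) then determines both variables.
  let E : ℝ → ℝ := fun t => Real.exp (-(2 / 3) * t)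
  let a : ℝ → ℝ := fun t => (√(1 + E t ^ 2))⁻¹
  have hE : ∀ t, HasDerivAt E (E t * -(2 / 3)) t := fun t =>
    (((hasDerivAt_id t).const_mul (-(2 / 3) : ℝ)).exp).congr_deriv (by simp [E])
  have hpos : ∀ t, 0 < √(1 + E t ^ 2) := fun t => Real.sqrt_pos.2 (by positivity)
  have ha2 : ∀ t, a t ^ 2 * (1 + E t ^ 2) = 1 := fun t => by
    have h1 : √(1 + E t ^ 2) ^ 2 = 1 + E t ^ 2 := Real.sq_sqrt (by positivity)
    have h2 : (1 + E t ^ 2) ≠ 0 := by positivity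
    simp only [a, inv_pow, h1]
    field_simp
  have had : ∀ t, HasDerivAt a (2 / 3 * a t * (E t * a t) ^ 2) t := by
    intro t
    have h1 := ((((hE t).pow 2).const_add 1).sqrt
      (show (1 : ℝ) + E t ^ 2 ≠ 0 by positivity)).inv (hpos t).ne'
    refine h1.congr_deriv ?_
    have := hpos t
    simp only [a]
    simp
    field_simp
  refine ⟨fun t => ![0, 0, a t, E t * a t], fun t _ => HasDerivAt.hasDerivWithinAt ?_,
    fun t => ⟨rfl, ?_, ?_, ?_⟩, fun h => ?_, ?_⟩
  · rw [hasDerivAt_pi]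
    intro i
    fin_cases i
    · simpa [quadField] using hasDerivAt_const t (0 : ℝ)
    · refine (hasDerivAt_const t (0 : ℝ)).congr_deriv ?_
      simp [quadField]
      linear_combination (-(1 / 6) * (3 * γ - 4)) * ha2 t
    · refine (had t).congr_deriv ?_
      simp [quadField]
      linear_combination (γ / 2 * a t) * ha2 t
    · refine ((hE t).mul (had t)).congr_deriv ?_
      simp [quadField]
      linear_combination (2 / 3 * E t * a t + (3 * γ - 4) / 6 * E t * a t) * ha2 t
  · simp only [Matrix.cons_val]
    have := ha2 t
    nlinarith
  · simp only [Matrix.cons_val, a]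
    positivity
  · simp only [Matrix.cons_val, a, E]
    positivity
  · have h3 := congrFun h 3
    simp [deSitter, E, a] at h3
  · have hElim : Tendsto E atTop (𝓝 0) :=
      Real.tendsto_exp_atBot.comp (tendsto_id.const_mul_atTop_of_neg (by norm_num))
    have halim : Tendsto a atTop (𝓝 1) := by
      have h1 : ContinuousAt (fun e : ℝ => (√(1 + e ^ 2))⁻¹) 0 :=
        ContinuousAt.inv₀ (by fun_prop) (by simp)
      have h2 := h1.tendsto
      simp only [ne_eq, OfNat.ofNat_ne_zero, not_false_eq_true, zero_pow, add_zero, Real.sqrt_one,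
        inv_one] at h2
      exact h2.comp hElim
    rw [tendsto_pi_nhds]
    intro i
    fin_cases i
    · exact tendsto_const_nhds
    · exact tendsto_const_nhds
    · exact halim
    · simpa [deSitter] using hElim.mul halim

theorem isSaddleOn_quadPhaseSpace (γ : ℝ) {ε : ℝ} (hε : 0 < ε) :
    IsSaddleOn (quadField γ) (quadPhaseSpace ε) deSitter := by
  have hc : 1 / (1 - Real.exp (√(2 / 3) / ε)) < 0 := by
    rw [one_div, inv_lt_zero, sub_neg]
    exact Real.one_lt_exp_iff.2 (by positivity)
  obtain ⟨z, hz, hzS, hz0, hzl⟩ := exists_solution_to_deSitter γ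
  obtain ⟨w, hw, hwS, hw0, hwl⟩ := exists_solution_from_deSitter γ hc
  refine ⟨quadField_deSitter γ, ⟨z, hz, fun t _ => ?_, hz0, hzl⟩, ⟨w, hw, hwS, hw0, hwl⟩⟩
  obtain ⟨h0, h1⟩ := hzS t
  exact ⟨by rw [h0]; exact hc.le, h0.le, h1⟩

/-! ### From the field equations to the normalized system. -/

/-- A nonnegative solution of a homogeneous linear equation has a differentiable square root. -/
theorem hasDerivAt_sqrt_of_linear {f p : ℝ → ℝ} {t : ℝ} (hp : ContinuousAt p t)
    (hf : ∀ᶠ s in 𝓝 t, HasDerivAt f (p s * f s) s) (hf0 : 0 ≤ f t) :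
    HasDerivAt (fun s => √(f s)) (p t / 2 * √(f t)) t := by
  rcases hf0.eq_or_lt with h0 | h0
  -- A zero of `f` forces `f` to vanish nearby by uniqueness, so the singularity of the square root
  -- is harmless.
  · have hz : f =ᶠ[𝓝 t] fun _ => 0 := by
      refine ODE_solution_unique_of_eventually (v := fun s x => p s * x) (K := ‖p t‖₊ + 1)
        (s := fun _ => univ) ?_ (hf.mono fun s hs => ⟨hs, mem_univ _⟩)
        (Eventually.of_forall fun s => ⟨by simpa using hasDerivAt_const s (0 : ℝ), mem_univ _⟩)
        h0.symm
      filter_upwards [hp.nnnorm.eventually (gt_mem_nhds (lt_add_one _))] with s hs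
      refine LipschitzOnWith.of_dist_le_mul fun x _ y _ => ?_
      rw [Real.dist_eq, ← mul_sub, abs_mul, Real.dist_eq]
      refine mul_le_mul_of_nonneg_right ?_ (abs_nonneg _)
      exact_mod_cast hs.le
    rw [← h0]
    refine ((hasDerivAt_const t (0 : ℝ)).congr_of_eventuallyEq ?_).congr_deriv (by simp)
    filter_upwards [hz] with s hs
    simp [hs]
  · refine (hf.self_of_nhds.sqrt h0.ne').congr_deriv ?_
    have h1 := Real.sqrt_pos.2 h0
    rw [div_eq_iff (by positivity)]
    linear_combination (-(p t)) * Real.sq_sqrt h0.le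

/-- For `φ ≥ 0` no absolute value is needed, so `√V` is smooth along the solution. -/
theorem sqrt_quadPotential {α φ : ℝ} (hα : 0 < α) (hφ : 0 ≤ φ) :
    √(quadPotential α φ) = (√(8 * α))⁻¹ * (1 - Real.exp (-(√(2 / 3) * φ))) := by
  have h1 : 0 ≤ 1 - Real.exp (-(√(2 / 3) * φ)) := by
    rw [sub_nonneg, Real.exp_le_one_iff]
    have : 0 ≤ √(2 / 3) * φ := by positivity
    linarith
  rw [quadPotential, Real.sqrt_mul (by positivity), Real.sqrt_sq h1, one_div, Real.sqrt_inv]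

theorem hasDerivAt_quadPotential (α φ : ℝ) :
    HasDerivAt (quadPotential α) (1 / (8 * α) * (2 * (1 - Real.exp (-(√(2 / 3) * φ)))
      * (√(2 / 3) * Real.exp (-(√(2 / 3) * φ))))) φ := by
  have h1 : HasDerivAt (fun φ => 1 - Real.exp (-(√(2 / 3) * φ)))
      (√(2 / 3) * Real.exp (-(√(2 / 3) * φ))) φ :=
    ((((hasDerivAt_id φ).const_mul (√(2 / 3))).neg.exp).const_sub 1).congr_deriv (by simp; ring)
  refine ((h1.pow 2).const_mul (1 / (8 * α))).congr_deriv ?_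
  norm_num

theorem deriv_log_quadCoupling (φ : ℝ) :
    deriv (fun p => Real.log (quadCoupling p)) φ = √(2 / 3) := by
  simp only [quadCoupling, Real.log_exp]
  simp

section Normalized

variable {α γ a b ε : ℝ} {H φ y ρ ρr : ℝ → ℝ}

theorem quadVars_mem_quadPhaseSpace (hα : 0 < α)
    (h : IsFlatFRWSolution (quadPotential α) quadCoupling γ a b H φ y ρ ρr) (hε : 0 < ε)
    {t : ℝ} (ht : t ∈ Ioo a b) (hφ : 1 / ε ≤ φ t) :
    quadVars α (H t) (φ t) (y t) (ρr t) ∈ quadPhaseSpace ε := by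
  have hH := h.H_pos t ht
  have hφ0 : 0 < φ t := (one_div_pos.2 hε).trans_le hφ
  have hc : 0 < √(2 / 3 : ℝ) := by positivity
  have h1 : 1 < Real.exp (√(2 / 3) / ε) := Real.one_lt_exp_iff.2 (by positivity)
  have h2 : Real.exp (√(2 / 3) / ε) ≤ Real.exp (√(2 / 3) * φ t) := by
    rw [Real.exp_le_exp, div_eq_mul_one_div]
    exact mul_le_mul_of_nonneg_left hφ hc.le
  have hV : 0 ≤ quadPotential α (φ t) := by
    unfold quadPotential
    positivity
  refine ⟨?_, ?_, ?_, ?_, ?_⟩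
  · simp only [quadVars, Matrix.cons_val]
    exact one_div_le_one_div_of_neg_of_le (by linarith) (by linarith)
  · simp only [quadVars, Matrix.cons_val]
    exact one_div_nonpos.2 (by linarith)
  · simp only [quadVars, Matrix.cons_val, div_pow, mul_pow, Real.sq_sqrt hV,
      Real.sq_sqrt (h.rhor_nonneg t ht), Real.sq_sqrt (show (0 : ℝ) ≤ 6 by norm_num),
      Real.sq_sqrt (show (0 : ℝ) ≤ 3 by norm_num)]
    have e : y t ^ 2 / (6 * H t ^ 2) + quadPotential α (φ t) / (3 * H t ^ 2) + ρr t / (3 * H t ^ 2)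
        = (1 / 2 * y t ^ 2 + quadPotential α (φ t) + ρr t) / (3 * H t ^ 2) := by
      field_simp
      ring
    rw [e, div_le_one (by positivity), h.friedmann t ht]
    linarith [h.rho_nonneg t ht]
  · simp only [quadVars, Matrix.cons_val]
    positivity
  · simp only [quadVars, Matrix.cons_val]
    positivity

/-- The Friedmann constraint eliminates `ρ`; after division by powers of `H` the equations are
polynomial in the normalized variables, and the factor `3 H` is `dτ/dt`. -/
theorem hasDerivAt_quadVars (hα : 0 < α)
    (h : IsFlatFRWSolution (quadPotential α) quadCoupling γ a b H φ y ρ ρr)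
    (hφ : ∀ t ∈ Ioo a b, 0 < φ t) {t : ℝ} (ht : t ∈ Ioo a b) :
    HasDerivAt (fun s => quadVars α (H s) (φ s) (y s) (ρr s))
      ((3 * H t) • quadField γ (quadVars α (H t) (φ t) (y t) (ρr t))) t := by
  have hH := h.H_pos t ht
  have hnhds := Ioo_mem_nhds ht.1 ht.2
  have dφ := h.phi_eq t ht
  have dH := h.H_eq t ht
  have dy := h.y_eq t ht
  have fr := h.friedmann t ht
  have hc : 0 < √(2 / 3 : ℝ) := by positivity
  have hc2 : √(2 / 3 : ℝ) ^ 2 = 2 / 3 := Real.sq_sqrt (by norm_num)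
  have h6 : √(6 : ℝ) = 3 * √(2 / 3) := by
    rw [← Real.sqrt_sq (show (0 : ℝ) ≤ 3 by norm_num), ← Real.sqrt_mul (by norm_num)]
    norm_num
  have hw : 0 < √(3 : ℝ) := by positivity
  have hw2 : √(3 : ℝ) ^ 2 = 3 := Real.sq_sqrt (by norm_num)
  have hR2 : √(ρr t) ^ 2 = ρr t := Real.sq_sqrt (h.rhor_nonneg t ht)
  have dR : HasDerivAt (fun s => √(ρr s)) (-4 * H t / 2 * √(ρr t)) t :=
    hasDerivAt_sqrt_of_linear (p := fun s => -4 * H s)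
      (dH.continuousAt.const_mul (-4)) (by filter_upwards [hnhds] with s hs using h.rhor_eq s hs)
      (h.rhor_nonneg t ht)
  rw [(hasDerivAt_quadPotential α (φ t)).deriv, deriv_log_quadCoupling] at dy
  have hV : quadPotential α (φ t) = (√(quadPotential α (φ t))) ^ 2 := by
    rw [Real.sq_sqrt]
    unfold quadPotential
    positivity
  have hKe := sqrt_quadPotential hα (hφ t ht).le
  have hexp : Real.exp (√(2 / 3) * φ t) = (Real.exp (-(√(2 / 3) * φ t)))⁻¹ := by
    rw [Real.exp_neg, inv_inv]
  have dv : HasDerivAt (fun s => √(quadPotential α (φ s)))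
      ((√(8 * α))⁻¹ * (√(2 / 3) * y t * Real.exp (-(√(2 / 3) * φ t)))) t := by
    have h1 := (((dφ.const_mul (√(2 / 3))).neg.exp).const_sub 1).const_mul (√(8 * α))⁻¹
    refine (h1.congr_of_eventuallyEq ?_).congr_deriv ?_
    · filter_upwards [hnhds] with s hs using sqrt_quadPotential hα (hφ s hs).le
    · simp only [Pi.neg_apply]
      ring
  have hE1 : Real.exp (-(√(2 / 3) * φ t)) < 1 := by
    rw [Real.exp_lt_one_iff]
    have := mul_pos hc (hφ t ht)
    linarith
  have hE0 := Real.exp_pos (-(√(2 / 3) * φ t))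
  have du : HasDerivAt (fun s => 1 / (1 - Real.exp (√(2 / 3) * φ s)))
      (√(2 / 3) * y t * Real.exp (√(2 / 3) * φ t) / (1 - Real.exp (√(2 / 3) * φ t)) ^ 2) t := by
    have h0 : 1 - Real.exp (√(2 / 3) * φ t) ≠ 0 := by
      have : 1 < Real.exp (√(2 / 3) * φ t) := Real.one_lt_exp_iff.2 (mul_pos hc (hφ t ht))
      linarith
    have h1 := (((dφ.const_mul (√(2 / 3))).exp).const_sub 1).inv h0
    simp only [one_div]
    refine h1.congr_deriv ?_
    ring
  have hK : 1 / (8 * α) = ((√(8 * α))⁻¹) ^ 2 := by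
    rw [inv_pow, Real.sq_sqrt (by positivity), one_div]
  rw [hK] at dy
  rw [hV] at fr
  have hρ : ρ t = 3 * H t ^ 2 - 1 / 2 * y t ^ 2 - √(quadPotential α (φ t)) ^ 2 - √(ρr t) ^ 2 := by
    rw [hR2]
    linarith
  have hu : 1 / (1 - Real.exp (√(2 / 3) * φ t)) = -(Real.exp (-(√(2 / 3) * φ t))
      / (1 - Real.exp (-(√(2 / 3) * φ t)))) := by
    rw [hexp]
    have h1 : 1 - Real.exp (-(√(2 / 3) * φ t)) ≠ 0 := by linarith
    have h2 : 1 - (Real.exp (-(√(2 / 3) * φ t)))⁻¹ ≠ 0 := by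
      rw [sub_ne_zero]
      exact ((one_lt_inv₀ hE0).2 hE1).ne
    have h3 : Real.exp (-(√(2 / 3) * φ t)) - 1 ≠ 0 := by linarith
    field_simp
    ring
  rw [← hR2, hρ] at dH
  rw [hρ] at dy
  rw [hasDerivAt_pi]
  simp only [quadVars]
  rw [hu, h6]
  rw [hexp] at du
  rw [hKe] at dH dy ⊢
  set e := Real.exp (-(√(2 / 3) * φ t))
  set c := √(2 / 3 : ℝ)
  set w := √(3 : ℝ)
  set K := (√(8 * α))⁻¹
  set R := √(ρr t)
  have he : 1 - e ≠ 0 := by linarith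
  -- Here `Y`, `v`, `q` are `σ₂`, `σ₄`, `σ₅`, and `U = -u`. Expressing all square roots through `c =
  -- √(2/3)` and `w = √3` (with `√6 = 3 c`) leaves identities modulo `c² = 2/3` and `w² = 3`.
  obtain ⟨Y, hY⟩ : ∃ Y, y t = 3 * c * H t * Y := ⟨y t / (3 * c * H t), by field_simp⟩
  obtain ⟨v, hv⟩ : ∃ v, K * (1 - e) = w * H t * v := ⟨K * (1 - e) / (w * H t), by field_simp⟩
  obtain ⟨q, hq⟩ : ∃ q, R = w * H t * q := ⟨R / (w * H t), by field_simp⟩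
  obtain ⟨U, hU⟩ : ∃ U, e / (1 - e) = U := ⟨_, rfl⟩
  -- The exponential left in `V'` and in the derivative of `√V` is absorbed: `K e = √V · U`.
  have hKeU : K * e = w * H t * v * U := by
    rw [← hv, ← hU]
    field_simp
  have e1 : y t / (3 * c * H t) = Y := by rw [hY]; field_simp
  have e2 : K * (1 - e) / (w * H t) = v := by rw [hv]; field_simp
  have e3 : R / (w * H t) = q := by rw [hq]; field_simp
  rw [e1, e2, e3, hU]
  have dH' : HasDerivAt H (-(1 / 2) * H t ^ 2 *
      (3 * γ * (1 - Y ^ 2 - v ^ 2 - q ^ 2) + 4 * q ^ 2 + 6 * Y ^ 2)) t := by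
    refine dH.congr_deriv ?_
    rw [hv, hY, hq]
    linear_combination (-(1 / 2) * H t ^ 2 * Y ^ 2 * (9 - 9 / 2 * γ)) * hc2
      + (-(1 / 2) * H t ^ 2 * (4 / 3 * q ^ 2 - γ * v ^ 2 - γ * q ^ 2)) * hw2
  have dy' : HasDerivAt y (c * H t ^ 2 * (-9 * Y - 6 * v ^ 2 * U
      + 3 / 2 * (4 - 3 * γ) * (1 - Y ^ 2 - v ^ 2 - q ^ 2))) t := by
    refine dy.congr_deriv ?_
    have h1 : K ^ 2 * (2 * (1 - e) * (c * e)) = 2 * c * (K * (1 - e)) * (K * e) := by ring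
    rw [h1, hKeU, hv, hY, hq]
    linear_combination (-(9 / 4) * (4 - 3 * γ) * c * H t ^ 2 * Y ^ 2) * hc2
      + c * H t ^ 2 * (-2 * v ^ 2 * U - 1 / 2 * (4 - 3 * γ) * (v ^ 2 + q ^ 2)) * hw2
  have dv' : HasDerivAt (fun s => √(quadPotential α (φ s)))
      (2 * w * H t ^ 2 * Y * v * U) t := by
    refine dv.congr_deriv ?_
    have h1 : K * (c * y t * e) = c * y t * (K * e) := by ring
    rw [h1, hKeU, hY]
    linear_combination (3 * w * H t ^ 2 * Y * v * U) * hc2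
  have hc0 := hc.ne'
  have hw0 := hw.ne'
  intro i
  fin_cases i
  · refine du.congr_deriv ?_
    have h1 : e⁻¹ / (1 - e⁻¹) ^ 2 = U * (1 + U) := by
      have h2 : 1 - e⁻¹ ≠ 0 := by
        rw [sub_ne_zero]
        exact ((one_lt_inv₀ hE0).2 hE1).ne
      have h3 : e - 1 ≠ 0 := by linarith
      rw [← hU]
      field_simp
      ring
    rw [mul_div_assoc, h1, hY]
    simp [quadField]
    linear_combination (3 * H t * Y * U * (1 + U)) * hc2
  · refine (dy'.div (dH'.const_mul (3 * c)) (by positivity)).congr_deriv ?_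
    rw [hY]
    simp [quadField]
    field_simp
    ring
  · refine (dv'.div (dH'.const_mul w) (by positivity)).congr_deriv ?_
    rw [hKe, hv]
    simp [quadField]
    field_simp
    ring
  · refine (dR.div (dH'.const_mul w) (by positivity)).congr_deriv ?_
    simp [quadField]
    field_simp
    have hq' : √(ρr t) = w * H t * q := hq
    simp only [hq, hq']
    ring

end Normalized

theorem mainTheorem5 (γ : ℝ) (hγ0 : 0 < γ) (hγ2 : γ < 2) (hγ : γ ≠ 4 / 3) :
    -- in the normalized variables and the time `τ`, `dτ = 3 H dt`, the field equations of quadratic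
    -- gravity become the system `z' = quadField γ z` on the phase space near `φ = +∞`
    (∀ (α a b : ℝ) (H φ y ρ ρr : ℝ → ℝ), 0 < α →
      IsFlatFRWSolution (quadPotential α) quadCoupling γ a b H φ y ρ ρr →
      ∀ ε > 0, (∀ t ∈ Set.Ioo a b, 1 / ε ≤ φ t) → ∀ t ∈ Set.Ioo a b,
        quadVars α (H t) (φ t) (y t) (ρr t) ∈ quadPhaseSpace ε ∧
        HasDerivAt (fun s => quadVars α (H s) (φ s) (y s) (ρr s))
          ((3 * H t) • quadField γ (quadVars α (H t) (φ t) (y t) (ρr t))) t) ∧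
    -- the de Sitter point is an equilibrium, it is unstable, and it is a saddle
    quadField γ deSitter = 0 ∧
    ¬ IsLyapunovStableOn (quadField γ) Set.univ deSitter ∧
    IsSaddleOn (quadField γ) Set.univ deSitter ∧
    (∀ ε > 0, ¬ IsLyapunovStableOn (quadField γ) (quadPhaseSpace ε) deSitter ∧
      IsSaddleOn (quadField γ) (quadPhaseSpace ε) deSitter) ∧
    -- it has local center manifolds, and on each of them the flow is `x' = -(2/3) x² + O(x³)`
    IsCenterForm (centerField γ) (centerBlock γ) ∧
    (∀ r : ℕ, ∃ (δ : ℝ) (h : ℝ → (Fin 3 → ℝ)), IsLocalCenterManifold (centerField γ) r δ h) ∧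
    (∀ (r : ℕ) (δ : ℝ) (h : ℝ → (Fin 3 → ℝ)), 1 ≤ r →
      IsLocalCenterManifold (centerField γ) r δ h →
      (fun x : ℝ => (centerField γ (x, h x)).1 - (-(2 / 3) * x ^ 2)) =O[𝓝 0] fun x => x ^ 3) := by
  refine ⟨fun α a b H φ y ρ ρr hα h ε hε hφ t ht =>
      ⟨quadVars_mem_quadPhaseSpace hα h hε ht (hφ t ht), hasDerivAt_quadVars hα h
        (fun s hs => (one_div_pos.2 hε).trans_le (hφ s hs)) ht⟩,
    quadField_deSitter γ, ?_, ?_, fun ε hε => ?_, isCenterForm_centerField hγ0,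
    exists_isLocalCenterManifold γ, fun r δ h hr H => H.flow_isBigO hγ0 hr⟩
  · exact not_isLyapunovStableOn_of_isSaddleOn
      ((isSaddleOn_quadPhaseSpace γ one_pos).mono (subset_univ _))
  · exact (isSaddleOn_quadPhaseSpace γ one_pos).mono (subset_univ _)
  · exact ⟨not_isLyapunovStableOn_of_isSaddleOn (isSaddleOn_quadPhaseSpace γ hε),
      isSaddleOn_quadPhaseSpace γ hε⟩
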